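/- Let $S$ be a closed orientable surface of genus $g\ge 1$ and let $(\alpha,\beta)$ be a minimal separating filling pair on $S$: $\alpha,\beta$ are simple closed curves in minimal position (that is, $|\alpha\cap\beta|=i(\alpha,\beta)$, where $i(\alpha,\beta)$ is the minimum of $|\alpha'\cap\beta|$ over simple closed curves $\alpha'$ freely homotopic to $\alpha$), every component of $S\setminus(\alpha\cup\beta)$ is a topological disc, $S\setminus\alpha$ is disconnected, and $i(\alpha,\beta)=2g$. Orient both curves, choose an initial arc on each, and label the successive sub-arcs between intersection points $\alpha_1,\dots,\alpha_{2g}$ and $\beta_1,\dots,\beta_{2g}$ along the orientations. Consider the ordered set $$A_g=\{\alpha_1,\beta_1,\dots,\alpha_{2g},\beta_{2g},\alpha_1^{-1},\beta_1^{-1},\dots,\alpha_{2g}^{-1},\beta_{2g}^{-1}\}.$$ Cutting $S$ along $\alpha\cup\beta$ gives polygons, oriented coherently by an orientation of $S$, whose sides are labelled by the elements of $A_g$, each element labelling exactly one side: the label of a side is the sub-arc to which it is glued, with exponent $-1$ if the clockwise direction along the polygon runs against the direction of the arc. Let $\phi=\phi^{(\alpha,\beta)}$ be the permutation of $\{1,\dots,8g\}$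 with $\phi(i)=j$ if the side labelled by the $i$-th element of $A_g$ is succeeded, clockwise along its polygon, by the side labelled by the $j$-th element. Then: 1. $\phi$ sends even numbers to odd numbers and odd numbers to even numbers. 2. $\phi$ is a product of two disjoint $4g$-cycles. 3. One of these cycles contains every element of $\{1,3,\dots,4g-1\}$ and the other every element of $\{4g+1,4g+3,\dots,8g-1\}$. 4. If one of the cycles contains an even number $2i$, then it contains $2i+4g \pmod{8g}$. 5. If one of the cycles contains a number of the form $4k+2$, then all even numbers in this cycle have this form; if it contains a number of the form $4k$, then all even numbers in this cycle have that form. 6. $\phi\, Q^{4g}\,\phi=\tau$, where $Q=(1,2,\dots,8g)$ and $$\tau=(1,3,\dots,4g-1)\,(2,4,\dots,4g)\,(8g-1,8g-3,\dots,4g+1)\,(8g,8g-2,\dots,4g+2).$$ -/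

import Mathlib

open scoped unitInterval

noncomputable section

namespace FillingPair

/-! ### Closed orientable surfaces and curves -/

/-- First homology of `S` (the abelianised fundamental group) is free abelian of rank `2g`.
A closed connected surface has this property exactly if it is orientable of genus `g`: the first
homology group of a non-orientable closed surface has an element of order two. -/
def OrientableOfGenus (S : Type*) [TopologicalSpace S] (g : ℕ) : Prop :=
  ∀ x : S, Nonempty (Abelianization (FundamentalGroup S x) ≃* Multiplicative (Fin (2 * g) → ℤ))

variable {S : Type*} [TopologicalSpace S]

/-- A closed curve `γ : ℝ/ℤ → S` is simple if it is injective. The parametrisation also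
orients it. -/
def IsSimpleClosed (γ : C(UnitAddCircle, S)) : Prop := Function.Injective γ

/-- Geometric intersection number: the least number of points of `α' ∩ β` for simple closed
curves `α'` freely homotopic to `α`. -/
def geomInter (α β : C(UnitAddCircle, S)) : ℕ∞ :=
  ⨅ α' ∈ {α' : C(UnitAddCircle, S) | IsSimpleClosed α' ∧ α'.Homotopic α},
    (Set.range α' ∩ Set.range β).encard

def InMinimalPosition (α β : C(UnitAddCircle, S)) : Prop :=
  (Set.range α ∩ Set.range β).encard = geomInter α β

/-- `(α, β)` is a filling pair: simple closed curves in minimal position such that every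
connected component of the complement of `α ∪ β` is a topological (open) disc. -/
structure IsFillingPair (α β : C(UnitAddCircle, S)) : Prop where
  simple_left : IsSimpleClosed α
  simple_right : IsSimpleClosed β
  minimal_position : InMinimalPosition α β
  discs : ∀ x ∈ (Set.range α ∪ Set.range β)ᶜ,
    Nonempty (connectedComponentIn (Set.range α ∪ Set.range β)ᶜ x ≃ₜ Metric.ball (0 : ℂ) 1)

/-- The complement of the curve is disconnected. -/
def IsSeparating (α : C(UnitAddCircle, S)) : Prop := ¬ IsPreconnected (Set.range α)ᶜ

/-- A minimally intersecting separating filling pair on a surface of genus `g`, with `α` the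
separating curve. -/
structure IsMinimalSeparatingFillingPair (g : ℕ) (α β : C(UnitAddCircle, S)) : Prop where
  filling : IsFillingPair α β
  separating : IsSeparating α
  inter : geomInter α β = ((2 * g : ℕ) : ℕ∞)

/-! ### Labelled filling pairs -/

/-- A labelling of the sub-arcs of `γ` cut out by its `n` intersection points with `δ`. The real
numbers `pt i` are all the parameters at which `γ` (viewed as a `1`-periodic function on `ℝ`) meets
`δ`, in increasing order, with period `n`; `pt 0` is the start of the initial arc. -/
structure Labelling (γ δ : C(UnitAddCircle, S)) (n : ℕ) where
  pt : ℤ → ℝ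
  strictMono : StrictMono pt
  periodic : ∀ i, pt (i + n) = pt i + 1
  meets_iff : ∀ x : ℝ, γ (x : UnitAddCircle) ∈ Set.range δ ↔ ∃ i, pt i = x

/-- The `i`-th sub-arc, counted from `0`, traversed in the direction of `γ` as `u` runs through
`[0, 1]`. -/
def Labelling.arc {γ δ : C(UnitAddCircle, S)} {n : ℕ} (l : Labelling γ δ n) (i : ℤ) (u : ℝ) : S :=
  γ ((l.pt i + u * (l.pt (i + 1) - l.pt i) : ℝ) : UnitAddCircle)

/-- The `8g` symbols `α₁, …, α_{2g}`, `β₁, …, β_{2g}` and their inverses; the index `i : Fin (2g)`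
stands for the subscript `i + 1`. -/
inductive Symbol (g : ℕ) : Type
  | alpha (i : Fin (2 * g)) : Symbol g
  | beta (i : Fin (2 * g)) : Symbol g
  | alphaInv (i : Fin (2 * g)) : Symbol g
  | betaInv (i : Fin (2 * g)) : Symbol g

/-- The position of a symbol in the ordered set
`α₁, β₁, …, α_{2g}, β_{2g}, α₁⁻¹, β₁⁻¹, …, α_{2g}⁻¹, β_{2g}⁻¹`, a number in `{1, …, 8g}`. -/
def Symbol.index {g : ℕ} : Symbol g → ℕ
  | .alpha i => 2 * (i + 1) - 1
  | .beta i => 2 * (i + 1)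
  | .alphaInv i => 4 * g + (2 * (i + 1) - 1)
  | .betaInv i => 4 * g + 2 * (i + 1)

/-- The set `{1, …, 8g}`, as the residues modulo `8g` (so `8g` is the residue `0`). -/
abbrev N (g : ℕ) : Type := ZMod (8 * g)

theorem index_bijective (g : ℕ) [NeZero g] :
    Function.Bijective (fun s : Symbol g => ((s.index : ℕ) : N g)) := by
  have hg : 0 < g := Nat.pos_of_ne_zero (NeZero.ne g)
  have bd : ∀ s : Symbol g, 1 ≤ s.index ∧ s.index ≤ 8 * g := by
    rintro (i | i | i | i) <;> have := i.2 <;> simp only [Symbol.index] <;> omega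
  constructor
  · intro s t h
    have h' : s.index = t.index := by
      have h1 : s.index ≡ t.index [MOD 8 * g] := (ZMod.natCast_eq_natCast_iff _ _ _).1 h
      have hs := bd s
      have ht := bd t
      rcases Nat.le_total s.index t.index with hle | hle
      · obtain ⟨c, hc⟩ := (Nat.modEq_iff_dvd' hle).1 h1
        rcases Nat.eq_zero_or_pos c with rfl | hc0
        · omega
        · have := Nat.le_mul_of_pos_right (8 * g) hc0
          omega
      · obtain ⟨c, hc⟩ := (Nat.modEq_iff_dvd' hle).1 h1.symm
        rcases Nat.eq_zero_or_pos c with rfl | hc0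
        · omega
        · have := Nat.le_mul_of_pos_right (8 * g) hc0
          omega
    rcases s with i | i | i | i <;> rcases t with j | j | j | j <;>
      have := i.2 <;> have := j.2 <;> simp only [Symbol.index] at h' <;>
      first
        | (exfalso; omega)
        | (congr 1; apply Fin.ext; omega)
  · intro k
    have key : ∀ m : ℕ, 1 ≤ m → m ≤ 8 * g → ∃ s : Symbol g, s.index = m := by
      intro m h1 h2
      rcases Nat.even_or_odd' m with ⟨c, rfl | rfl⟩
      · by_cases hm : c ≤ 2 * g
        · exact ⟨.beta ⟨c - 1, by omega⟩, by simp only [Symbol.index]; omega⟩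
        · exact ⟨.betaInv ⟨c - 2 * g - 1, by omega⟩, by simp only [Symbol.index]; omega⟩
      · by_cases hm : c < 2 * g
        · exact ⟨.alpha ⟨c, by omega⟩, by simp only [Symbol.index]; omega⟩
        · exact ⟨.alphaInv ⟨c - 2 * g, by omega⟩, by simp only [Symbol.index]; omega⟩
    have hlt : k.val < 8 * g := ZMod.val_lt k
    by_cases h0 : k.val = 0
    · obtain ⟨s, hs⟩ := key (8 * g) (by omega) le_rfl
      refine ⟨s, ?_⟩
      have hk : k = 0 := (ZMod.val_eq_zero k).1 h0
      simp only [hs, hk, ZMod.natCast_self]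
    · obtain ⟨s, hs⟩ := key k.val (by omega) hlt.le
      exact ⟨s, by simp only [hs]; exact ZMod.natCast_zmod_val k⟩

/-- The numbering of the symbols by `{1, …, 8g}`. -/
def Symbol.equivN (g : ℕ) [NeZero g] : Symbol g ≃ N g :=
  Equiv.ofBijective _ (index_bijective g)

/-! ### Cutting the surface along the two curves -/

/-- The directed arc named by a symbol, parametrised by `u ∈ [0, 1]`. -/
def dirArc {α β : C(UnitAddCircle, S)} {g : ℕ} (a : Labelling α β (2 * g))
    (b : Labelling β α (2 * g)) : Symbol g → ℝ → S
  | .alpha i, u => a.arc (i : ℕ) u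
  | .beta i, u => b.arc (i : ℕ) u
  | .alphaInv i, u => a.arc (i : ℕ) (1 - u)
  | .betaInv i, u => b.arc (i : ℕ) (1 - u)

/-- The points of the `k`-th side of an `n`-gon, as `u` runs through `[0, 1]`. The `n`-gon is the
closed unit disc with boundary circle divided into `n` equal sides, which are numbered and
traversed clockwise. -/
def sidePoint (n k : ℕ) (u : ℝ) : ℂ :=
  Complex.exp (-(2 * Real.pi * (((k : ℝ) + u) / n) : ℝ) * Complex.I)

/-- The labelled polygons obtained by cutting the surface along `α ∪ β`: finitely many polygons
with a map to `S` that glues them back to `S`. It maps the interiors bijectively onto the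
complement of `α ∪ β`, and every side onto a sub-arc of `α` or `β`. The label of a side names that
arc with the direction in which it is traversed when the boundary of the polygon is traversed
clockwise. Every symbol labels exactly one side; in particular the two sides glued along an arc are
traversed in opposite directions, that is, the clockwise directions of all the polygons come from
one orientation of `S`. -/
structure CutPolygons {α β : C(UnitAddCircle, S)} {g : ℕ} (a : Labelling α β (2 * g))
    (b : Labelling β α (2 * g)) where
  /-- the number of polygons -/
  num : ℕ
  /-- the number of sides of each polygon -/
  sides : Fin num → ℕ
  sides_pos : ∀ f, 0 < sides f
  /-- the gluing map on each polygon -/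
  toSurface : Fin num → ℂ → S
  continuousOn : ∀ f, ContinuousOn (toSurface f) (Metric.closedBall 0 1)
  interior_notMem : ∀ f, ∀ z ∈ Metric.ball (0 : ℂ) 1,
    toSurface f z ∉ Set.range α ∪ Set.range β
  interior_bijective : ∀ x ∉ Set.range α ∪ Set.range β,
    ∃! p : Fin num × ℂ, p.2 ∈ Metric.ball (0 : ℂ) 1 ∧ toSurface p.1 p.2 = x
  /-- the label of each side -/
  label : (Σ f : Fin num, Fin (sides f)) ≃ Symbol g
  side_eq : ∀ (f : Fin num) (k : Fin (sides f)), ∀ u ∈ I,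
    toSurface f (sidePoint (sides f) k u) = dirArc a b (label ⟨f, k⟩) u

/-- The permutation `φ^{(α,β)}` of `{1, …, 8g}`: `φ(i) = j` if the side labelled by the `i`-th
symbol is succeeded, clockwise along its polygon, by the side labelled by the `j`-th symbol. -/
def CutPolygons.perm {α β : C(UnitAddCircle, S)} {g : ℕ} [NeZero g]
    {a : Labelling α β (2 * g)} {b : Labelling β α (2 * g)} (P : CutPolygons a b) :
    Equiv.Perm (N g) :=
  (P.label.trans (Symbol.equivN g)).permCongr
    (Equiv.Perm.sigmaCongrRight fun f => finRotate (P.sides f))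

/-! ### The permutations `Q` and `τ` -/

/-- `(e 0, e 1, …, e (m - 1))`, a cycle in cycle notation. -/
def cyc (g m : ℕ) (e : ℕ → ℕ) : Equiv.Perm (N g) :=
  ((List.range m).map fun i => ((e i : ℕ) : N g)).formPerm

/-- `Q = (1, 2, …, 8g)`. -/
def Q (g : ℕ) : Equiv.Perm (N g) := cyc g (8 * g) fun i => i + 1

/-- `(1, 3, …, 4g-1) (2, 4, …, 4g) (8g-1, 8g-3, …, 4g+1) (8g, 8g-2, …, 4g+2)`. -/
def tau (g : ℕ) : Equiv.Perm (N g) :=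
  cyc g (2 * g) (fun i => 2 * i + 1) * cyc g (2 * g) (fun i => 2 * i + 2) *
    cyc g (2 * g) (fun i => 8 * g - 1 - 2 * i) * cyc g (2 * g) (fun i => 8 * g - 2 * i)

end FillingPair

end

/-! Write `next` for "following side, clockwise" and let ψ send a symbol s to the reversal of `next
s`. At the corner where s ends, ψ rotates about that intersection point v, taking one directed arc
ending at v to a neighbouring one. Four directed arcs end at v, two on each curve. Two facts
determine how ψ acts on them. A punctured neighbourhood of v in S is connected, so ψ has a single
orbit (`mem_of_invariant`). Minimal position forbids a corner between two consecutive arcs of α,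
since replacing that stretch of α by a chord of the polygon would remove v from the intersection
(`next_ne_succ`). A 4-cycle in which the two α-arcs are not neighbours alternates between α and β,
and ψ² exchanges opposite arcs (`alternating_of_transitive`). Hence `next` exchanges α-sides and
β-sides, which is item 1, and `next` ∘ reversal ∘ `next` is the successor along the curve. Since
reversal is `Q ^ (4 * g)` and the successor is `tau`, this is item 6.

The remaining items describe the polygons, which are the cycles of φ. There are 2g vertices and 4g
edges, so the Euler characteristic allows at most two polygons (`num_le_two`). This is proved by
linear algebra: homology coordinates, functions on vertices and functions on polygons together
inject into functions on edges plus two normalising constants, because cellular cocycles are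
orthogonal to boundaries of polygons. The topological input is that a homotopy-invariant additive
function of paths which is a coboundary on the arcs vanishes on every closed path
(`toFun_eq_zero_of_arcs`).

As α separates, no point off α may lie in the images of all the polygons. So there are exactly two
polygons, and each β-arc has the same polygon on both sides (`num_eq_two_and_face_inv_eq`). Moving
along α crosses only β-arcs and therefore stays in one polygon: one polygon contains every α_i, the
other every inverse. Moving along β crosses α and changes polygon at each step, so the polygon of
β_i depends on the parity of i. Each polygon has 2g sides on α, alternating with 2g sides on β
(`face_structure`, `perm_structure`). -/

noncomputable section

namespace FillingPair

variable {S : Type*} [TopologicalSpace S]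

/-! ### The sub-arcs of a labelled curve -/

namespace Labelling

variable {γ δ : C(UnitAddCircle, S)} {n : ℕ}

/-- The parameter on `γ` of the point at position `u` of the `i`-th sub-arc. -/
def pos (l : Labelling γ δ n) (i : ℤ) (u : ℝ) : ℝ := l.pt i + u * (l.pt (i + 1) - l.pt i)

theorem arc_eq_pos (l : Labelling γ δ n) (i : ℤ) (u : ℝ) :
    l.arc i u = γ ((l.pos i u : ℝ) : UnitAddCircle) := rfl

theorem pt_lt_succ (l : Labelling γ δ n) (i : ℤ) : l.pt i < l.pt (i + 1) :=
  l.strictMono (by omega)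

@[simp] theorem pos_zero (l : Labelling γ δ n) (i : ℤ) : l.pos i 0 = l.pt i := by simp [pos]

@[simp] theorem pos_one (l : Labelling γ δ n) (i : ℤ) : l.pos i 1 = l.pt (i + 1) := by simp [pos]

theorem pos_strictMono (l : Labelling γ δ n) (i : ℤ) : StrictMono (l.pos i) := by
  intro u v h
  have := mul_lt_mul_of_pos_right h (sub_pos.2 (l.pt_lt_succ i))
  simp only [pos]
  linarith

theorem pt_add_mul (l : Labelling γ δ n) (i m : ℤ) : l.pt (i + n * m) = l.pt i + m := by
  induction m using Int.induction_on with
  | zero => simp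
  | succ k ih =>
    have := l.periodic (i + n * k)
    rw [mul_add, mul_one, ← add_assoc, this, ih]
    push_cast; ring
  | pred k ih =>
    have := l.periodic (i + n * (-k - 1))
    rw [show i + n * (-(k : ℤ) - 1) + n = i + n * (-k) by ring, ih] at this
    push_cast at this ⊢
    linarith

theorem pos_add_mul (l : Labelling γ δ n) (i m : ℤ) (u : ℝ) :
    l.pos (i + n * m) u = l.pos i u + m := by
  have h := l.pt_add_mul (i + 1) m
  rw [show i + 1 + n * m = i + n * m + 1 by ring] at h
  simp only [pos, h, l.pt_add_mul]
  ring

theorem coe_add_int (x : ℝ) (m : ℤ) : ((x + m : ℝ) : UnitAddCircle) = (x : UnitAddCircle) := by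
  rw [AddCircle.coe_add]
  have : ((m : ℝ) : UnitAddCircle) = 0 := AddCircle.coe_eq_zero_iff _ |>.2 ⟨m, by simp⟩
  rw [this, add_zero]

theorem arc_add_mul (l : Labelling γ δ n) (i m : ℤ) (u : ℝ) : l.arc (i + n * m) u = l.arc i u := by
  rw [arc_eq_pos, arc_eq_pos, pos_add_mul, coe_add_int]

theorem exists_eq_add_of_apply_eq (hγ : IsSimpleClosed γ) {x y : ℝ}
    (h : γ (x : UnitAddCircle) = γ (y : UnitAddCircle)) : ∃ m : ℤ, x = y + m := by
  have h1 := hγ h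
  have h2 : ((x - y : ℝ) : UnitAddCircle) = 0 := by rw [AddCircle.coe_sub, h1, sub_self]
  obtain ⟨m, hm⟩ := (AddCircle.coe_eq_zero_iff _).1 h2
  exact ⟨m, by simp at hm; linarith⟩

theorem continuous_arc (l : Labelling γ δ n) (i : ℤ) : Continuous (l.arc i) := by
  have : Continuous (l.pos i) := by unfold pos; fun_prop
  exact γ.continuous.comp ((AddCircle.continuous_mk' 1).comp this)

/-- Periodicity makes `pt` unbounded in both directions, so there is a greatest index whose
parameter is at most `x`. -/
theorem exists_pt_le_lt (l : Labelling γ δ n) (x : ℝ) : ∃ i, l.pt i ≤ x ∧ x < l.pt (i + 1) := by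
  have hb : ∃ b : ℤ, ∀ z : ℤ, l.pt z ≤ x → z ≤ b := by
    obtain ⟨m, hm⟩ := exists_int_gt (x - l.pt 0)
    refine ⟨0 + n * m, fun z hz => ?_⟩
    by_contra hc
    have := l.strictMono (not_le.1 hc)
    rw [pt_add_mul] at this
    linarith
  have hi : ∃ z : ℤ, l.pt z ≤ x := by
    obtain ⟨m, hm⟩ := exists_int_lt (x - l.pt 0)
    exact ⟨0 + n * m, by rw [pt_add_mul]; linarith⟩
  obtain ⟨i, hi, hmax⟩ := Int.exists_greatest_of_bdd hb hi
  refine ⟨i, hi, ?_⟩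
  by_contra hc
  have := hmax (i + 1) (not_lt.1 hc)
  omega

theorem exists_pos_eq (l : Labelling γ δ n) (x : ℝ) : ∃ i, ∃ u ∈ I, l.pos i u = x := by
  obtain ⟨i, h1, h2⟩ := l.exists_pt_le_lt x
  have hp := sub_pos.2 (l.pt_lt_succ i)
  refine ⟨i, (x - l.pt i) / (l.pt (i + 1) - l.pt i), ⟨?_, ?_⟩, ?_⟩
  · exact div_nonneg (by linarith) hp.le
  · rw [div_le_one hp]; linarith
  · unfold pos; field_simp; ring

theorem exists_arc_eq (l : Labelling γ δ n) (hn : 0 < n) {y : S} (hy : y ∈ Set.range γ) :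
    ∃ i : Fin n, ∃ u ∈ I, l.arc (i : ℕ) u = y := by
  obtain ⟨x, rfl⟩ := hy
  obtain ⟨x, rfl⟩ := QuotientAddGroup.mk_surjective x
  obtain ⟨i, u, hu, h⟩ := l.exists_pos_eq x
  have hn' : (n : ℤ) ≠ 0 := by omega
  have h0 := Int.emod_nonneg i hn'
  have h1 := Int.emod_lt_of_pos i (show (0 : ℤ) < n by omega)
  refine ⟨⟨(i % n).toNat, by omega⟩, u, hu, ?_⟩
  have h3 := l.arc_add_mul (i % n) (i / n) u
  rw [Int.emod_add_mul_ediv] at h3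
  simp only [Int.toNat_of_nonneg h0, ← h3, arc_eq_pos, h]

/-- The parameter intervals of different arcs have disjoint interiors, so a parameter common to two
of them is an end of both. -/
theorem pos_eq_pos (l : Labelling γ δ n) {i j : ℤ} {u v : ℝ} (hu : u ∈ I) (hv : v ∈ I)
    (h : l.pos i u = l.pos j v) :
    (i = j ∧ u = v) ∨ (u = 0 ∨ u = 1) ∧ (v = 0 ∨ v = 1) := by
  have key : ∀ {i j : ℤ} {u v : ℝ}, u ∈ I → v ∈ I → i < j → l.pos i u = l.pos j v →
      u = 1 ∧ v = 0 := by
    intro i j u v hu hv hij h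
    have h1 : l.pos i u ≤ l.pt (i + 1) := by
      rw [← pos_one]; exact (l.pos_strictMono i).monotone hu.2
    have h2 : l.pt j ≤ l.pos j v := by
      rw [← pos_zero]; exact (l.pos_strictMono j).monotone hv.1
    have h3 : l.pt (i + 1) ≤ l.pt j := l.strictMono.monotone (by omega)
    constructor
    · apply (l.pos_strictMono i).injective
      rw [pos_one]; linarith
    · apply (l.pos_strictMono j).injective
      rw [pos_zero]; linarith
  rcases lt_trichotomy i j with hij | rfl | hij
  · obtain ⟨rfl, rfl⟩ := key hu hv hij h
    simp
  · exact Or.inl ⟨rfl, (l.pos_strictMono i).injective h⟩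
  · obtain ⟨rfl, rfl⟩ := key hv hu hij h.symm
    simp

theorem arc_eq_arc (l : Labelling γ δ n) (hγ : IsSimpleClosed γ) {i j : Fin n} {u v : ℝ}
    (hu : u ∈ I) (hv : v ∈ I) (h : l.arc (i : ℕ) u = l.arc (j : ℕ) v) :
    (i = j ∧ u = v) ∨ (u = 0 ∨ u = 1) ∧ (v = 0 ∨ v = 1) := by
  obtain ⟨m, hm⟩ := exists_eq_add_of_apply_eq hγ h
  change l.pos _ _ = l.pos _ _ + _ at hm
  rw [← pos_add_mul] at hm
  rcases l.pos_eq_pos hu hv hm with ⟨h1, h2⟩ | h1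
  · refine Or.inl ⟨Fin.ext ?_, h2⟩
    have h3 := congrArg (· % (n : ℤ)) h1
    simp only [Int.add_mul_emod_self_left] at h3
    rw [Int.emod_eq_of_lt (by omega) (by omega), Int.emod_eq_of_lt (by omega) (by omega)] at h3
    omega
  · exact Or.inr h1

theorem pos_mem_iff (l : Labelling γ δ n) (i : ℤ) {u : ℝ} (hu : u ∈ I) :
    γ ((l.pos i u : ℝ) : UnitAddCircle) ∈ Set.range δ ↔ u = 0 ∨ u = 1 := by
  rw [l.meets_iff]
  constructor
  · rintro ⟨k, hk⟩
    rw [← pos_zero] at hk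
    rcases l.pos_eq_pos (by simp) hu hk with ⟨h1, h2⟩ | h1
    · exact Or.inl h2.symm
    · exact h1.2
  · rintro (rfl | rfl)
    · exact ⟨i, by simp⟩
    · exact ⟨i + 1, by simp⟩

theorem apply_pt_eq (l : Labelling γ δ n) (hγ : IsSimpleClosed γ) {i j : ℤ}
    (h : γ (l.pt i : UnitAddCircle) = γ (l.pt j : UnitAddCircle)) : i % n = j % n := by
  obtain ⟨m, hm⟩ := exists_eq_add_of_apply_eq hγ h
  rw [← pt_add_mul] at hm
  rw [l.strictMono.injective hm, Int.add_mul_emod_self_left]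

theorem apply_pt_congr (l : Labelling γ δ n) {i j : ℤ} (h : i % n = j % n) :
    γ (l.pt i : UnitAddCircle) = γ (l.pt j : UnitAddCircle) := by
  have h1 := Int.emod_add_mul_ediv i n
  have h2 := Int.emod_add_mul_ediv j n
  rw [← h1, ← h2, h, pt_add_mul, pt_add_mul, coe_add_int, coe_add_int]

end Labelling

/-! ### Symbols and directed arcs -/

namespace Symbol

variable {g : ℕ}

/-- The symbol of the same arc with the opposite direction. -/
def inv : Symbol g → Symbol g
  | alpha i => alphaInv i
  | beta i => betaInv i
  | alphaInv i => alpha i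
  | betaInv i => beta i

@[simp] theorem inv_alpha (i : Fin (2 * g)) : (alpha i).inv = alphaInv i := rfl
@[simp] theorem inv_beta (i : Fin (2 * g)) : (beta i).inv = betaInv i := rfl
@[simp] theorem inv_alphaInv (i : Fin (2 * g)) : (alphaInv i).inv = alpha i := rfl
@[simp] theorem inv_betaInv (i : Fin (2 * g)) : (betaInv i).inv = beta i := rfl
@[simp] theorem inv_inv (s : Symbol g) : s.inv.inv = s := by cases s <;> rfl

theorem inv_injective : Function.Injective (inv (g := g)) :=
  Function.LeftInverse.injective inv_inv

/-- The symbol of the arc which follows on the same curve in the same direction. -/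
def succ : Symbol g → Symbol g
  | alpha i => alpha (finRotate _ i)
  | beta i => beta (finRotate _ i)
  | alphaInv i => alphaInv ((finRotate _).symm i)
  | betaInv i => betaInv ((finRotate _).symm i)

/-- The symbol names an arc of `α`. -/
def IsAlpha : Symbol g → Prop
  | alpha _ => True
  | beta _ => False
  | alphaInv _ => True
  | betaInv _ => False

@[simp] theorem isAlpha_alpha (i : Fin (2 * g)) : (alpha i).IsAlpha := trivial
@[simp] theorem isAlpha_alphaInv (i : Fin (2 * g)) : (alphaInv i).IsAlpha := trivial
@[simp] theorem not_isAlpha_beta (i : Fin (2 * g)) : ¬ (beta i).IsAlpha := id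
@[simp] theorem not_isAlpha_betaInv (i : Fin (2 * g)) : ¬ (betaInv i).IsAlpha := id

@[simp] theorem isAlpha_inv (s : Symbol g) : s.inv.IsAlpha ↔ s.IsAlpha := by cases s <;> simp

end Symbol

theorem finRotate_val_emod {n : ℕ} (i : Fin n) : ((finRotate n i : ℕ) : ℤ) = ((i : ℤ) + 1) % n := by
  have := i.2
  obtain ⟨m, rfl⟩ : ∃ m, n = m + 1 := ⟨n - 1, by omega⟩
  by_cases h : i = Fin.last m
  · subst h
    simp
  · have h1 := coe_finRotate_of_ne_last h
    have h2 : (i : ℕ) ≠ m := fun h' => h (Fin.ext h')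
    rw [h1]
    push_cast
    rw [Int.emod_eq_of_lt (by omega) (by omega)]

variable {α β : C(UnitAddCircle, S)} {g : ℕ} (a : Labelling α β (2 * g)) (b : Labelling β α (2 * g))

/-- The directed arc of a symbol as a continuous map on the unit interval. -/
def arcMap (s : Symbol g) : C(I, S) where
  toFun u := dirArc a b s u
  continuous_toFun := by
    cases s with
    | alpha i => exact (a.continuous_arc _).comp continuous_subtype_val
    | beta i => exact (b.continuous_arc _).comp continuous_subtype_val
    | alphaInv i =>
      exact (a.continuous_arc _).comp (continuous_const.sub continuous_subtype_val)
    | betaInv i =>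
      exact (b.continuous_arc _).comp (continuous_const.sub continuous_subtype_val)

theorem dirArc_inv (s : Symbol g) (u : ℝ) : dirArc a b s.inv u = dirArc a b s (1 - u) := by
  cases s <;> simp [dirArc]

theorem one_sub_mem {u : ℝ} (hu : u ∈ I) : 1 - u ∈ I := ⟨by linarith [hu.2], by linarith [hu.1]⟩

theorem dirArc_mem_inter_iff (s : Symbol g) {u : ℝ} (hu : u ∈ I) :
    dirArc a b s u ∈ Set.range α ∩ Set.range β ↔ u = 0 ∨ u = 1 := by
  have h1 : ∀ i {u}, u ∈ I → (a.arc i u ∈ Set.range α ∩ Set.range β ↔ u = 0 ∨ u = 1) := by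
    intro i u hu
    rw [Set.mem_inter_iff, Labelling.arc_eq_pos, a.pos_mem_iff i hu]
    simp
  have h2 : ∀ i {u}, u ∈ I → (b.arc i u ∈ Set.range α ∩ Set.range β ↔ u = 0 ∨ u = 1) := by
    intro i u hu
    rw [Set.mem_inter_iff, Labelling.arc_eq_pos, b.pos_mem_iff i hu]
    simp
  have h3 : (1 - u = 0 ∨ 1 - u = 1) ↔ (u = 0 ∨ u = 1) := by
    constructor <;> rintro (h | h)
    · right; linarith
    · left; linarith
    · right; linarith
    · left; linarith
  cases s with
  | alpha i => exact h1 _ hu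
  | beta i => exact h2 _ hu
  | alphaInv i => exact (h1 _ (one_sub_mem hu)).trans h3
  | betaInv i => exact (h2 _ (one_sub_mem hu)).trans h3

theorem dirArc_mem_left {s : Symbol g} (hs : s.IsAlpha) (u : ℝ) :
    dirArc a b s u ∈ Set.range α := by
  cases s with
  | alpha i => exact Set.mem_range_self _
  | alphaInv i => exact Set.mem_range_self _
  | beta i => exact hs.elim
  | betaInv i => exact hs.elim

theorem dirArc_mem_right {s : Symbol g} (hs : ¬ s.IsAlpha) (u : ℝ) :
    dirArc a b s u ∈ Set.range β := by
  cases s with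
  | beta i => exact Set.mem_range_self _
  | betaInv i => exact Set.mem_range_self _
  | alpha i => exact absurd trivial hs
  | alphaInv i => exact absurd trivial hs

theorem dirArc_mem_union (s : Symbol g) (u : ℝ) :
    dirArc a b s u ∈ Set.range α ∪ Set.range β := by
  by_cases hs : s.IsAlpha
  · exact Or.inl (dirArc_mem_left a b hs u)
  · exact Or.inr (dirArc_mem_right a b hs u)

theorem exists_dirArc_eq [NeZero g] {x : S} (hx : x ∈ Set.range α ∪ Set.range β) :
    ∃ s, ∃ u ∈ I, dirArc a b s u = x := by
  have hg := NeZero.pos g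
  rcases hx with hx | hx
  · obtain ⟨i, u, hu, h⟩ := a.exists_arc_eq (by omega) hx
    exact ⟨.alpha i, u, hu, h⟩
  · obtain ⟨i, u, hu, h⟩ := b.exists_arc_eq (by omega) hx
    exact ⟨.beta i, u, hu, h⟩

/-- Two points on directed arcs agree only if they are the same point of the same arc, or if both
are end points. -/
theorem dirArc_eq_dirArc (hα : IsSimpleClosed α) (hβ : IsSimpleClosed β) {s t : Symbol g} {u v : ℝ}
    -- A point of both curves is an end of every arc through it. Any other point determines its
    -- curve, and simplicity of that curve then determines the undirected arc and the position on
    -- it.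
    (hu : u ∈ I) (hv : v ∈ I) (h : dirArc a b s u = dirArc a b t v) :
    (s = t ∧ u = v) ∨ (t = s.inv ∧ v = 1 - u) ∨ (u = 0 ∨ u = 1) ∧ (v = 0 ∨ v = 1) := by
  by_cases hx : dirArc a b s u ∈ Set.range α ∩ Set.range β
  · exact Or.inr (Or.inr ⟨(dirArc_mem_inter_iff a b s hu).1 hx,
      (dirArc_mem_inter_iff a b t hv).1 (h ▸ hx)⟩)
  · have hv' : ¬ (v = 0 ∨ v = 1) := by
      rwa [← dirArc_mem_inter_iff a b t hv, ← h]
    have hu' := one_sub_mem hu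
    have hw' := one_sub_mem hv
    have hne : ¬ (s.IsAlpha ∧ ¬ t.IsAlpha) := fun h' =>
      hx ⟨dirArc_mem_left a b h'.1 u, h ▸ dirArc_mem_right a b h'.2 v⟩
    have hne' : ¬ (t.IsAlpha ∧ ¬ s.IsAlpha) := fun h' =>
      hx ⟨h ▸ dirArc_mem_left a b h'.1 v, dirArc_mem_right a b h'.2 u⟩
    have hA : ∀ {i j : Fin (2 * g)} {u v : ℝ}, u ∈ I → v ∈ I → ¬ (v = 0 ∨ v = 1) →
        a.arc (i : ℕ) u = a.arc (j : ℕ) v → i = j ∧ u = v := fun h1 h2 h3 h4 =>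
      (a.arc_eq_arc hα h1 h2 h4).resolve_right fun h5 => h3 h5.2
    have hB : ∀ {i j : Fin (2 * g)} {u v : ℝ}, u ∈ I → v ∈ I → ¬ (v = 0 ∨ v = 1) →
        b.arc (i : ℕ) u = b.arc (j : ℕ) v → i = j ∧ u = v := fun h1 h2 h3 h4 =>
      (b.arc_eq_arc hβ h1 h2 h4).resolve_right fun h5 => h3 h5.2
    have hw : ¬ (1 - v = 0 ∨ 1 - v = 1) := by
      rintro (h | h)
      · exact hv' (Or.inr (by linarith))
      · exact hv' (Or.inl (by linarith))
    cases s <;> cases t <;> simp only [dirArc] at h <;>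
      first
      | exact (hne ⟨trivial, id⟩).elim
      | exact (hne' ⟨trivial, id⟩).elim
      | (obtain ⟨rfl, h'⟩ := hA hu hv hv' h; exact Or.inl ⟨rfl, h'⟩)
      | (obtain ⟨rfl, h'⟩ := hB hu hv hv' h; exact Or.inl ⟨rfl, h'⟩)
      | (obtain ⟨rfl, h'⟩ := hA hu hw' hw h; exact Or.inr (Or.inl ⟨rfl, by linarith⟩))
      | (obtain ⟨rfl, h'⟩ := hB hu hw' hw h; exact Or.inr (Or.inl ⟨rfl, by linarith⟩))
      | (obtain ⟨rfl, h'⟩ := hA hu' hv hv' h; exact Or.inr (Or.inl ⟨rfl, by linarith⟩))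
      | (obtain ⟨rfl, h'⟩ := hB hu' hv hv' h; exact Or.inr (Or.inl ⟨rfl, by linarith⟩))
      | (obtain ⟨rfl, h'⟩ := hA hu' hw' hw h; exact Or.inl ⟨rfl, by linarith⟩)
      | (obtain ⟨rfl, h'⟩ := hB hu' hw' hw h; exact Or.inl ⟨rfl, by linarith⟩)

theorem dirArc_alpha_zero (i : Fin (2 * g)) :
    dirArc a b (.alpha i) 0 = α (a.pt i : UnitAddCircle) := by
  simp [dirArc, Labelling.arc_eq_pos]

theorem dirArc_alpha_one (i : Fin (2 * g)) :
    dirArc a b (.alpha i) 1 = α (a.pt (i + 1) : UnitAddCircle) := by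
  simp [dirArc, Labelling.arc_eq_pos]

theorem dirArc_beta_one (i : Fin (2 * g)) :
    dirArc a b (.beta i) 1 = β (b.pt (i + 1) : UnitAddCircle) := by
  simp [dirArc, Labelling.arc_eq_pos]

theorem dirArc_alphaInv_one (i : Fin (2 * g)) :
    dirArc a b (.alphaInv i) 1 = α (a.pt i : UnitAddCircle) := by
  simp [dirArc, Labelling.arc_eq_pos]

theorem dirArc_betaInv_one (i : Fin (2 * g)) :
    dirArc a b (.betaInv i) 1 = β (b.pt i : UnitAddCircle) := by
  simp [dirArc, Labelling.arc_eq_pos]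

/-- At the wrap-around the parameter changes by one period, which the circle does not see. The
statement is applied to either curve. -/
theorem alpha_pt_finRotate (i : Fin (2 * g)) :
    α (a.pt ((finRotate _ i : Fin (2 * g)) : ℕ) : UnitAddCircle)
      = α (a.pt (i + 1) : UnitAddCircle) := by
  apply a.apply_pt_congr
  rw [finRotate_val_emod]
  simp

/-- The end point of an arc is the initial point of the next arc. -/
theorem dirArc_succ_zero (s : Symbol g) : dirArc a b s.succ 0 = dirArc a b s 1 := by
  have key : ∀ {γ δ : C(UnitAddCircle, S)} (l : Labelling γ δ (2 * g)) (i : Fin (2 * g)),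
      l.arc ((finRotate _ i : Fin (2 * g)) : ℕ) 0 = l.arc (i : ℕ) 1 := by
    intro γ δ l i
    simp only [Labelling.arc_eq_pos, Labelling.pos_zero, Labelling.pos_one]
    exact alpha_pt_finRotate l i
  cases s with
  | alpha i => exact key a i
  | beta i => exact key b i
  | alphaInv i =>
    have := key a ((finRotate _).symm i)
    rw [Equiv.apply_symm_apply] at this
    simpa [dirArc, Symbol.succ] using this.symm
  | betaInv i =>
    have := key b ((finRotate _).symm i)
    rw [Equiv.apply_symm_apply] at this
    simpa [dirArc, Symbol.succ] using this.symm

/-- Exactly four directed arcs end at a point of intersection. -/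
theorem exists_incoming [NeZero g] (hα : IsSimpleClosed α) (hβ : IsSimpleClosed β) {v : S}
    (hv : v ∈ Set.range α ∩ Set.range β) : ∃ i j : Fin (2 * g), ∀ s, dirArc a b s 1 = v ↔
      s = .alpha i ∨ s = (Symbol.alpha i).succ.inv ∨ s = .beta j ∨ s = (Symbol.beta j).succ.inv := by
  have hg := NeZero.pos g
  have key : ∀ {γ δ : C(UnitAddCircle, S)} (l : Labelling γ δ (2 * g)), IsSimpleClosed γ →
      v ∈ Set.range γ → v ∈ Set.range δ → ∃ i : Fin (2 * g),
      (∀ k : Fin (2 * g), γ (l.pt (k + 1) : UnitAddCircle) = v ↔ k = i) ∧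
      (∀ k : Fin (2 * g), γ (l.pt k : UnitAddCircle) = v ↔ k = finRotate _ i) := by
    intro γ δ l hγ h1 h2
    have h0 : ∃ k : Fin (2 * g), γ (l.pt k : UnitAddCircle) = v := by
      obtain ⟨k, u, hu, h⟩ := l.exists_arc_eq (by omega) h1
      have h3 : u = 0 ∨ u = 1 := by
        rw [← l.pos_mem_iff k hu, ← l.arc_eq_pos, h]; exact h2
      rcases h3 with rfl | rfl
      · exact ⟨k, by rw [← h, l.arc_eq_pos]; simp⟩
      · refine ⟨finRotate _ k, ?_⟩
        rw [alpha_pt_finRotate l, ← h, l.arc_eq_pos]; simp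
    obtain ⟨k, hk⟩ := h0
    have hinj : ∀ {p q : Fin (2 * g)}, γ (l.pt p : UnitAddCircle) = γ (l.pt q : UnitAddCircle) →
        p = q := by
      intro p q h
      have h3 := l.apply_pt_eq hγ h
      rw [Int.emod_eq_of_lt (by omega) (by omega), Int.emod_eq_of_lt (by omega) (by omega)] at h3
      exact Fin.ext (by omega)
    refine ⟨(finRotate _).symm k, fun p => ?_, fun p => ?_⟩
    · rw [← alpha_pt_finRotate l, ← hk, Equiv.eq_symm_apply]
      exact ⟨fun h => hinj h, fun h => by rw [h]⟩
    · rw [← hk, Equiv.apply_symm_apply]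
      exact ⟨fun h => hinj h, fun h => by rw [h]⟩
  obtain ⟨i, hi1, hi2⟩ := key a hα hv.1 hv.2
  obtain ⟨j, hj1, hj2⟩ := key b hβ hv.2 hv.1
  refine ⟨i, j, fun s => ?_⟩
  cases s with
  | alpha k => rw [dirArc_alpha_one, hi1]; simp [Symbol.succ]
  | beta k => rw [dirArc_beta_one, hj1]; simp [Symbol.succ]
  | alphaInv k => rw [dirArc_alphaInv_one, hi2]; simp [Symbol.succ]
  | betaInv k => rw [dirArc_betaInv_one, hj2]; simp [Symbol.succ]

open Metric Set Filter Topology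

/-! ### Points on the boundary of a polygon -/

@[simp] theorem norm_sidePoint (n k : ℕ) (u : ℝ) : ‖sidePoint n k u‖ = 1 := by
  unfold sidePoint
  rw [← Complex.ofReal_neg]
  exact Complex.norm_exp_ofReal_mul_I _

theorem sidePoint_mem (n k : ℕ) (u : ℝ) : sidePoint n k u ∈ closedBall (0 : ℂ) 1 := by
  simp

theorem continuous_sidePoint (n k : ℕ) : Continuous (sidePoint n k) := by
  unfold sidePoint
  fun_prop

theorem sidePoint_one (n k : ℕ) : sidePoint n k 1 = sidePoint n (k + 1) 0 := by
  simp [sidePoint]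

theorem sidePoint_eq_iff {n : ℕ} (hn : 0 < n) (k k' : ℕ) (u u' : ℝ) :
    sidePoint n k u = sidePoint n k' u' ↔ ∃ m : ℤ, (k : ℝ) + u = k' + u' + n * m := by
  have hn' : (n : ℂ) ≠ 0 := by exact_mod_cast hn.ne'
  have hpi : (2 * Real.pi * Complex.I : ℂ) ≠ 0 := Complex.two_pi_I_ne_zero
  unfold sidePoint
  rw [Complex.exp_eq_exp_iff_exists_int]
  constructor
  · rintro ⟨m, hm⟩
    refine ⟨-m, ?_⟩
    have h1 : (2 * Real.pi * Complex.I : ℂ) * ((k : ℂ) + u) =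
        (2 * Real.pi * Complex.I : ℂ) * (k' + u' + n * (-m)) := by
      push_cast at hm
      field_simp at hm
      linear_combination (-2 * Real.pi * Complex.I) * hm
    have h2 := mul_left_cancel₀ hpi h1
    exact_mod_cast h2
  · rintro ⟨m, hm⟩
    refine ⟨-m, ?_⟩
    have h2 : ((k : ℂ) + u) = (k' + u' + n * m) := by exact_mod_cast hm
    push_cast
    field_simp
    linear_combination (-1 : ℂ) * h2

theorem sidePoint_finRotate {n : ℕ} (k : Fin n) :
    sidePoint n (finRotate n k) 0 = sidePoint n k 1 := by
  have hn : 0 < n := k.pos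
  rw [sidePoint_eq_iff hn]
  have h1 := finRotate_val_emod k
  have h2 := Int.emod_add_mul_ediv ((k : ℤ) + 1) n
  rw [← h1] at h2
  refine ⟨-(((k : ℤ) + 1) / n), ?_⟩
  have h3 : (((finRotate n k : ℕ) : ℤ) : ℝ) + n * ((((k : ℤ) + 1) / n : ℤ) : ℝ) = k + 1 := by
    exact_mod_cast h2
  push_cast at h3 ⊢
  linarith

theorem sidePoint_one_injective {n : ℕ} {k k' : Fin n}
    (h : sidePoint n k 1 = sidePoint n k' 1) : k = k' := by
  have hn : 0 < n := k.pos
  obtain ⟨m, hm⟩ := (sidePoint_eq_iff hn _ _ _ _).1 h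
  have h1 : (k : ℤ) = k' + n * m := by
    have : ((k : ℕ) : ℝ) = k' + n * m := by linarith
    exact_mod_cast this
  have h2 := congrArg (· % (n : ℤ)) h1
  simp only [Int.add_mul_emod_self_left] at h2
  rw [Int.emod_eq_of_lt (by omega) (by omega), Int.emod_eq_of_lt (by omega) (by omega)] at h2
  exact Fin.ext (by omega)

theorem exists_sidePoint_eq {n : ℕ} (hn : 0 < n) {z : ℂ} (hz : ‖z‖ = 1) :
    ∃ k : Fin n, ∃ u ∈ I, sidePoint n k u = z := by
  have hn0 : (0 : ℝ) < n := by exact_mod_cast hn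
  -- The clockwise angle of `z` in units of one side: its floor, reduced modulo `n`, is the side,
  -- and its fractional part is the position on that side.
  set θ : ℝ := -(n * z.arg / (2 * Real.pi)) with hθ
  have hn' : (n : ℤ) ≠ 0 := by omega
  have h0 := Int.emod_nonneg ⌊θ⌋ hn'
  have h1 := Int.emod_lt_of_pos ⌊θ⌋ (show (0 : ℤ) < n by omega)
  have h2 := Int.emod_add_mul_ediv ⌊θ⌋ n
  refine ⟨⟨(⌊θ⌋ % n).toNat, by omega⟩, Int.fract θ, ⟨Int.fract_nonneg _, (Int.fract_lt_one _).le⟩,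
    ?_⟩
  have h3 : sidePoint n (⌊θ⌋ % n).toNat (Int.fract θ) = sidePoint n 0 θ := by
    rw [sidePoint_eq_iff hn]
    refine ⟨-(⌊θ⌋ / n), ?_⟩
    have h4 : (((⌊θ⌋ % n).toNat : ℤ) : ℝ) + n * ((⌊θ⌋ / n : ℤ) : ℝ) = ⌊θ⌋ := by
      rw [Int.toNat_of_nonneg h0]; exact_mod_cast h2
    have h5 := Int.floor_add_fract θ
    push_cast at h4 ⊢
    linarith
  rw [h3]
  have h6 : (-(2 * Real.pi * (((0 : ℕ) + θ) / n)) : ℝ) = z.arg := by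
    rw [hθ]; push_cast; field_simp; ring
  unfold sidePoint
  rw [← Complex.ofReal_neg, h6]
  have := Complex.norm_mul_exp_arg_mul_I z
  rwa [hz, Complex.ofReal_one, one_mul] at this

/-! ### The sides of the polygons, indexed by their labels -/

namespace CutPolygons

variable {α β : C(UnitAddCircle, S)} {g : ℕ} {a : Labelling α β (2 * g)} {b : Labelling β α (2 * g)}
  (P : CutPolygons a b)

/-- The polygon with a side labelled by the symbol. -/
def face (s : Symbol g) : Fin P.num := (P.label.symm s).1

/-- The label of the side which succeeds the given side clockwise. -/
def next : Equiv.Perm (Symbol g) :=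
  P.label.permCongr (Equiv.Perm.sigmaCongrRight fun f => finRotate (P.sides f))

/-- The points of the side labelled by the symbol. -/
def point (s : Symbol g) (u : ℝ) : ℂ := sidePoint (P.sides (P.face s)) (P.label.symm s).2 u

theorem next_label (f : Fin P.num) (k : Fin (P.sides f)) :
    P.next (P.label ⟨f, k⟩) = P.label ⟨f, finRotate _ k⟩ := by
  simp [next, Equiv.Perm.sigmaCongrRight]

theorem face_label (f : Fin P.num) (k : Fin (P.sides f)) : P.face (P.label ⟨f, k⟩) = f := by
  simp [face]

theorem point_label (f : Fin P.num) (k : Fin (P.sides f)) (u : ℝ) :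
    P.point (P.label ⟨f, k⟩) u = sidePoint (P.sides f) k u := by
  have key : ∀ (s : Symbol g) (p : Σ f, Fin (P.sides f)), P.label.symm s = p →
      P.point s u = sidePoint (P.sides p.1) p.2 u := by
    rintro s p rfl
    rfl
  exact key (P.label ⟨f, k⟩) ⟨f, k⟩ (P.label.symm_apply_apply ⟨f, k⟩)

theorem exists_label_eq (s : Symbol g) : ∃ f k, P.label ⟨f, k⟩ = s :=
  ⟨_, _, P.label.apply_symm_apply s⟩

@[simp] theorem face_next (s : Symbol g) : P.face (P.next s) = P.face s := by
  obtain ⟨f, k, rfl⟩ := P.exists_label_eq s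
  rw [next_label, face_label, face_label]

theorem point_next_zero (s : Symbol g) : P.point (P.next s) 0 = P.point s 1 := by
  obtain ⟨f, k, rfl⟩ := P.exists_label_eq s
  rw [next_label, point_label, point_label, sidePoint_finRotate]

theorem point_mem (s : Symbol g) (u : ℝ) : P.point s u ∈ closedBall (0 : ℂ) 1 :=
  sidePoint_mem _ _ _

theorem continuous_point (s : Symbol g) : Continuous (P.point s) := continuous_sidePoint _ _

theorem toSurface_point (s : Symbol g) {u : ℝ} (hu : u ∈ I) :
    P.toSurface (P.face s) (P.point s u) = dirArc a b s u := by
  have := P.side_eq (P.label.symm s).1 (P.label.symm s).2 u hu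
  rwa [Sigma.eta, Equiv.apply_symm_apply] at this

theorem dirArc_next_zero (s : Symbol g) : dirArc a b (P.next s) 0 = dirArc a b s 1 := by
  rw [← P.toSurface_point s (by simp), ← P.toSurface_point (P.next s) (by simp), face_next,
    point_next_zero]

theorem exists_point_eq (f : Fin P.num) {z : ℂ} (hz : ‖z‖ = 1) :
    ∃ s, P.face s = f ∧ ∃ u ∈ I, P.point s u = z := by
  obtain ⟨k, u, hu, h⟩ := exists_sidePoint_eq (P.sides_pos f) hz
  exact ⟨P.label ⟨f, k⟩, P.face_label f k, u, hu, by rw [point_label, h]⟩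

theorem point_one_injective {s t : Symbol g} (hf : P.face s = P.face t)
    (h : P.point s 1 = P.point t 1) : s = t := by
  obtain ⟨f, k, rfl⟩ := P.exists_label_eq s
  obtain ⟨f', k', rfl⟩ := P.exists_label_eq t
  rw [face_label, face_label] at hf
  subst hf
  rw [point_label, point_label] at h
  rw [sidePoint_one_injective h]

/-! ### The gluing map -/

theorem norm_eq_one_of_mem (f : Fin P.num) {z : ℂ} (hz : z ∈ closedBall (0 : ℂ) 1)
    (h : P.toSurface f z ∈ range α ∪ range β) : ‖z‖ = 1 := by
  rw [mem_closedBall_zero_iff] at hz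
  refine hz.antisymm (not_lt.1 fun h' => P.interior_notMem f z ?_ h)
  rwa [mem_ball_zero_iff]

/-- Boundary points of the polygons land on the curves and interior points do not, so a second
preimage of an interior point would again be interior, where the gluing map is injective. -/
theorem eq_of_toSurface_eq {f f' : Fin P.num} {z z' : ℂ} (hz : z ∈ ball (0 : ℂ) 1)
    (hz' : z' ∈ closedBall (0 : ℂ) 1) (h : P.toSurface f' z' = P.toSurface f z) :
    f' = f ∧ z' = z := by
  have h1 := P.interior_notMem f z hz
  have h2 : z' ∈ ball (0 : ℂ) 1 := by
    rw [mem_closedBall_zero_iff] at hz'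
    rw [mem_ball_zero_iff]
    refine lt_of_le_of_ne hz' fun h3 => h1 ?_
    obtain ⟨s, rfl, u, hu, rfl⟩ := P.exists_point_eq f' h3
    rw [← h, P.toSurface_point s hu]
    exact dirArc_mem_union a b s u
  have := (P.interior_bijective _ h1).unique (y₁ := (f', z')) (y₂ := (f, z)) ⟨h2, h⟩ ⟨hz, rfl⟩
  exact Prod.mk.inj this

theorem exists_toSurface_eq [NeZero g] (x : S) :
    ∃ f, ∃ z ∈ closedBall (0 : ℂ) 1, P.toSurface f z = x := by
  by_cases hx : x ∈ range α ∪ range β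
  · obtain ⟨s, u, hu, rfl⟩ := exists_dirArc_eq a b hx
    exact ⟨P.face s, P.point s u, P.point_mem s u, P.toSurface_point s hu⟩
  · obtain ⟨p, ⟨hp, h⟩, -⟩ := P.interior_bijective x hx
    exact ⟨p.1, p.2, ball_subset_closedBall hp, h⟩

/-- A point of the surface on an open arc has its two preimages on the sides labelled by the arc
and by its inverse. -/
theorem eq_point_of_toSurface_eq (hα : IsSimpleClosed α) (hβ : IsSimpleClosed β) {s : Symbol g}
    {u : ℝ} (hu : u ∈ I) (h0 : u ≠ 0) (h1 : u ≠ 1) {f : Fin P.num} {z : ℂ}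
    (hz : z ∈ closedBall (0 : ℂ) 1) (h : P.toSurface f z = dirArc a b s u) :
    (f = P.face s ∧ z = P.point s u) ∨ (f = P.face s.inv ∧ z = P.point s.inv (1 - u)) := by
  have hz1 := P.norm_eq_one_of_mem f hz (h ▸ dirArc_mem_union a b s u)
  obtain ⟨t, rfl, v, hv, rfl⟩ := P.exists_point_eq f hz1
  rw [P.toSurface_point t hv] at h
  rcases dirArc_eq_dirArc a b hα hβ hu hv h.symm with ⟨rfl, rfl⟩ | ⟨rfl, rfl⟩ | ⟨h2, -⟩
  · exact Or.inl ⟨rfl, rfl⟩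
  · exact Or.inr ⟨rfl, rfl⟩
  · exact absurd h2 (by tauto)

/-- A set is open if its preimages in the polygons are. -/
theorem isOpen_of_preimage [NeZero g] [T2Space S] {V : Set S}
    (h : ∀ f, ∀ z ∈ closedBall (0 : ℂ) 1, P.toSurface f z ∈ V →
      ∀ᶠ w in 𝓝[closedBall 0 1] z, P.toSurface f w ∈ V) : IsOpen V := by
  have h1 : Vᶜ = ⋃ f, P.toSurface f '' (closedBall 0 1 ∩ P.toSurface f ⁻¹' Vᶜ) := by
    ext x
    simp only [mem_iUnion]
    constructor
    · intro hx
      obtain ⟨f, z, hz, rfl⟩ := P.exists_toSurface_eq x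
      exact ⟨f, z, ⟨hz, hx⟩, rfl⟩
    · rintro ⟨f, z, ⟨-, hz⟩, rfl⟩
      exact hz
  rw [← isClosed_compl_iff, h1]
  -- The complement of `V` is a finite union of images of compact sets, hence closed in the
  -- Hausdorff space `S`: the gluing map is a quotient map.
  refine isClosed_iUnion_of_finite fun f => IsCompact.isClosed (IsCompact.image_of_continuousOn ?_
    ((P.continuousOn f).mono inter_subset_left))
  refine (isCompact_closedBall (0 : ℂ) 1).of_isClosed_subset ?_ inter_subset_left
  rw [← isOpen_compl_iff, isOpen_iff_mem_nhds]
  intro z hz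
  by_cases hzD : z ∈ closedBall (0 : ℂ) 1
  · have hzV : P.toSurface f z ∈ V := by
      by_contra hc
      exact hz ⟨hzD, hc⟩
    filter_upwards [mem_nhdsWithin_iff_eventually.1 (h f z hzD hzV)] with w hw hw'
    exact hw'.2 (hw hw'.1)
  · filter_upwards [isClosed_closedBall.isOpen_compl.mem_nhds hzD] with w hw hw'
    exact hw hw'.1

/-! ### The components of the complement of a separating curve -/

/-- The set lies between the open disc, which misses the preimage of α, and its closure, so it is
preconnected. -/
theorem isPreconnected_image_compl (f : Fin P.num) :
    IsPreconnected (P.toSurface f '' (closedBall 0 1 ∩ P.toSurface f ⁻¹' (range α)ᶜ)) := by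
  refine IsPreconnected.image (IsPreconnected.subset_closure
    (isPreconnected_ball (x := (0 : ℂ)) (r := 1)) ?_ ?_) _
    ((P.continuousOn f).mono inter_subset_left)
  · intro z hz
    exact ⟨ball_subset_closedBall hz, fun h => P.interior_notMem f z hz (Or.inl h)⟩
  · rw [closure_ball _ one_ne_zero]
    exact inter_subset_left

/-- The complement of α is the union of the preconnected images of the polygons with α removed, and
here all of these share the point `x`. -/
theorem isPreconnected_compl [NeZero g] {x : S}
    (h : ∀ f, ∃ z ∈ closedBall (0 : ℂ) 1, x ∉ range α ∧ P.toSurface f z = x) :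
    IsPreconnected (range α)ᶜ := by
  have h1 : (range α)ᶜ =
      ⋃ f, P.toSurface f '' (closedBall 0 1 ∩ P.toSurface f ⁻¹' (range α)ᶜ) := by
    ext y
    simp only [mem_iUnion]
    constructor
    · intro hx
      obtain ⟨f, z, hz, rfl⟩ := P.exists_toSurface_eq y
      exact ⟨f, z, ⟨hz, hx⟩, rfl⟩
    · rintro ⟨f, z, ⟨-, hz⟩, rfl⟩
      exact hz
  rw [h1]
  refine isPreconnected_iUnion ⟨x, mem_iInter.2 fun f => ?_⟩ P.isPreconnected_image_compl
  obtain ⟨z, hz, hx, hzx⟩ := h f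
  exact ⟨z, ⟨hz, by rw [mem_preimage, hzx]; exact hx⟩, hzx⟩

/-- If there are at most two polygons, then there are exactly two, and each arc of the other curve
borders only one of them. -/
theorem num_eq_two_and_face_inv_eq [NeZero g] (hnum : P.num ≤ 2) (hsep : IsSeparating α) :
    P.num = 2 ∧ ∀ s : Symbol g, ¬ s.IsAlpha → P.face s.inv = P.face s := by
  have hhalf : (1 / 2 : ℝ) ∈ I := ⟨by norm_num, by norm_num⟩
  have h1 : ∀ s : Symbol g, ¬ s.IsAlpha → P.face s.inv = P.face s := by
    intro s hs
    by_contra hne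
    -- The midpoint of a β-arc lies off α. If the arc bordered two different polygons, these would
    -- be all the polygons, and the midpoint would join them.
    refine hsep (P.isPreconnected_compl (x := dirArc a b s (1 / 2)) fun f => ?_)
    have hx : dirArc a b s (1 / 2) ∉ range α := by
      intro h
      have := (dirArc_mem_inter_iff a b s hhalf).1 ⟨h, dirArc_mem_right a b hs _⟩
      norm_num at this
    have hf : f = P.face s ∨ f = P.face s.inv := by
      have h1 := f.2
      have h2 := (P.face s).2
      have h3 := (P.face s.inv).2
      have h4 : (P.face s.inv : ℕ) ≠ P.face s := fun h => hne (Fin.ext h)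
      simp only [Fin.ext_iff]
      omega
    rcases hf with rfl | rfl
    · exact ⟨_, P.point_mem s _, hx, P.toSurface_point s hhalf⟩
    · refine ⟨_, P.point_mem s.inv (1 / 2), hx, ?_⟩
      rw [P.toSurface_point s.inv hhalf, dirArc_inv]
      norm_num
  refine ⟨?_, h1⟩
  by_contra hne
  have hpos : 0 < P.num := (P.face (.alpha ⟨0, by have := NeZero.pos g; omega⟩)).pos
  -- With only one polygon its centre serves as the common point.
  refine hsep (P.isPreconnected_compl (x := P.toSurface ⟨0, hpos⟩ 0) fun f => ⟨0, by simp, ?_, ?_⟩)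
  · exact fun h => P.interior_notMem ⟨0, hpos⟩ 0 (by simp) (Or.inl h)
  · congr 1
    exact Fin.ext (by have := f.2; simp; omega)

end CutPolygons

/-! ### Neighbourhoods of intersection points: the sectors around a vertex. -/

/-- Every point of a surface has arbitrarily small neighbourhoods homeomorphic to the plane. -/
theorem exists_isOpenEmbedding_plane [ChartedSpace (EuclideanSpace ℝ (Fin 2)) S] {v : S} {W : Set S}
    (hW : W ∈ 𝓝 v) : ∃ h : C(EuclideanSpace ℝ (Fin 2), S), IsOpenEmbedding h ∧ h 0 = v ∧
      range h ⊆ W := by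
  set e := chartAt (EuclideanSpace ℝ (Fin 2)) v
  have hv : v ∈ e.source := mem_chart_source _ v
  have h1 : e.target ∩ e.symm ⁻¹' W ∈ 𝓝 (e v) := by
    refine inter_mem (e.open_target.mem_nhds (e.map_source hv)) ?_
    refine (e.continuousAt_symm (e.map_source hv)) ?_
    rwa [e.left_inv hv]
  obtain ⟨r, hr, hball⟩ := Metric.mem_nhds_iff.1 h1
  set k := (OpenPartialHomeomorph.univBall (e v) r).trans e.symm
  have hmem : ∀ x, OpenPartialHomeomorph.univBall (e v) r x ∈ ball (e v) r := by
    intro x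
    rw [← OpenPartialHomeomorph.univBall_target (e v) hr]
    exact (OpenPartialHomeomorph.univBall (e v) r).map_source (by simp)
  have hk : k.source = univ := by
    ext x
    simp only [k, OpenPartialHomeomorph.trans_source, OpenPartialHomeomorph.univBall_source,
      mem_inter_iff, mem_univ, true_and, iff_true]
    exact (hball (hmem x)).1
  have hopen := k.isOpenEmbedding hk
  refine ⟨⟨k, hopen.continuous⟩, hopen, ?_, ?_⟩
  · change e.symm (OpenPartialHomeomorph.univBall (e v) r 0) = v
    rw [OpenPartialHomeomorph.univBall_apply_zero, e.left_inv hv]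
  · rintro _ ⟨x, rfl⟩
    exact (hball (hmem x)).2

/-- This is where the surface is used to be a manifold of dimension two: removing a point from the
plane does not disconnect it, so the sectors at a vertex cannot form two fans meeting only at that
vertex. -/
theorem isPreconnected_range_diff {h : C(EuclideanSpace ℝ (Fin 2), S)} (hh : IsOpenEmbedding h) :
    IsPreconnected (range h \ {h 0}) := by
  have h1 : range h \ {h 0} = h '' {0}ᶜ := by
    rw [compl_eq_univ_sdiff, image_sdiff hh.injective, image_univ, image_singleton]
  rw [h1]
  refine IsPreconnected.image (isConnected_compl_singleton_of_one_lt_rank ?_ 0).isPreconnected _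
    h.continuous.continuousOn
  rw [← Module.finrank_eq_rank]
  simp

instance {g : ℕ} : Finite (Symbol g) :=
  Finite.of_injective (fun s : Symbol g => match s with
    | .alpha i => (0, i) | .beta i => (1, i) | .alphaInv i => (2, i) | .betaInv i => (3, i) :
      Symbol g → Fin 4 × Fin (2 * g)) (by
    intro s t h
    cases s <;> cases t <;> simp_all)

namespace CutPolygons

variable {α β : C(UnitAddCircle, S)} {g : ℕ} {a : Labelling α β (2 * g)} {b : Labelling β α (2 * g)}
  (P : CutPolygons a b)

/-- Going around a point of the surface, one meets all arcs which end there. -/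
theorem mem_of_invariant [NeZero g] [T2Space S] [ChartedSpace (EuclideanSpace ℝ (Fin 2)) S]
    (hα : IsSimpleClosed α) (hβ : IsSimpleClosed β) {v : S} {A : Set (Symbol g)}
    (hA : ∀ s ∈ A, dirArc a b s 1 = v) (hne : A.Nonempty) (hinv : ∀ s ∈ A, (P.next s).inv ∈ A)
    {s : Symbol g} (hs : dirArc a b s 1 = v) : s ∈ A := by
  classical
  by_contra hsA
  have hv : v ∈ range α ∩ range β := by
    rw [← hs, dirArc_mem_inter_iff a b s (by simp)]; simp
  -- An injective self-map of a finite set permutes any subset it preserves, so invariance also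
  -- holds backwards.
  have hinv' : ∀ s, (P.next s).inv ∈ A → s ∈ A := by
    let ψ : Equiv.Perm (Symbol g) := P.next.trans ⟨Symbol.inv, Symbol.inv, Symbol.inv_inv,
      Symbol.inv_inv⟩
    intro s h
    have := Equiv.Perm.perm_symm_on_of_perm_on_finite (f := ψ) (p := (· ∈ A)) hinv h
    rwa [show (P.next s).inv = ψ s from rfl, Equiv.symm_apply_apply] at this
  -- The corners over `v` are divided according to whether the side ending there lies in `A`. `O₁`
  -- and `O₂` are disjoint neighbourhoods of the two kinds of corner. The goal is to let them
  -- separate a punctured neighbourhood of `v`.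
  let C₁ : Fin P.num → Set ℂ := fun f => {z | ∃ s ∈ A, P.face s = f ∧ P.point s 1 = z}
  let C₂ : Fin P.num → Set ℂ := fun f =>
    {z | ∃ s ∉ A, dirArc a b s 1 = v ∧ P.face s = f ∧ P.point s 1 = z}
  have hsep : ∀ f, SeparatedNhds (C₁ f) (C₂ f) := by
    intro f
    have hfin : ∀ C : Set ℂ, C ⊆ range (fun s => P.point s 1) → IsCompact C := fun C hC =>
      ((finite_range _).subset hC).isCompact
    refine SeparatedNhds.of_isCompact_isCompact (hfin _ ?_) (hfin _ ?_) (disjoint_left.2 ?_)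
    · rintro _ ⟨s, -, -, rfl⟩
      exact ⟨s, rfl⟩
    · rintro _ ⟨s, -, -, -, rfl⟩
      exact ⟨s, rfl⟩
    · rintro _ ⟨s, hs, hf, rfl⟩ ⟨t, ht, -, hf', h⟩
      exact ht (P.point_one_injective (hf'.trans hf.symm) h ▸ hs)
  choose O₁ O₂ hO₁ hO₂ hC₁ hC₂ hdisj using hsep
  let O : Symbol g → Set ℂ := fun s => if s ∈ A then O₁ (P.face s) else O₂ (P.face s)
  have hO : ∀ s, IsOpen (O s) := by
    intro s
    simp only [O]
    split_ifs
    · exact hO₁ _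
    · exact hO₂ _
  have hcorner : ∀ s, dirArc a b s 1 = v → P.point s 1 ∈ O s := by
    intro s hs
    simp only [O]
    split_ifs with h
    · exact hC₁ _ ⟨s, h, rfl, rfl⟩
    · exact hC₂ _ ⟨s, h, hs, rfl, rfl⟩
  -- The part to be avoided on the half-sides adjacent to the corner at the end of `s`. If this
  -- corner does not lie over `v`, the implication is vacuous and the entire closed half-side is
  -- avoided.
  let B : Symbol g → Set ℝ := fun s =>
    {u | u ∈ Icc (1 / 2) 1 ∧ (dirArc a b s 1 = v → P.point s u ∉ O s)}
  let B' : Symbol g → Set ℝ := fun s =>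
    {u | u ∈ Icc 0 (1 / 2) ∧ (dirArc a b s 1 = v → P.point (P.next s) u ∉ O s)}
  have hBI : ∀ s, ∀ u ∈ B s, u ∈ I := fun s u hu => ⟨by linarith [hu.1.1], hu.1.2⟩
  have hBI' : ∀ s, ∀ u ∈ B' s, u ∈ I := fun s u hu => ⟨hu.1.1, by linarith [hu.1.2]⟩
  have hclosed : ∀ s t, IsClosed {u : ℝ | dirArc a b s 1 = v → P.point t u ∉ O s} := by
    intro s t
    by_cases h : dirArc a b s 1 = v
    · simp only [h, forall_const]
      exact ((hO s).preimage (P.continuous_point t)).isClosed_compl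
    · simp [h]
  have hB : ∀ s, IsCompact (B s) := fun s => isCompact_Icc.inter_right (hclosed s s)
  have hB' : ∀ s, IsCompact (B' s) := fun s => isCompact_Icc.inter_right (hclosed s _)
  have himg : ∀ f (K : Set ℂ), K ⊆ closedBall 0 1 → IsCompact K →
      IsClosed (P.toSurface f '' K) := fun f K h1 h2 =>
    (h2.image_of_continuousOn ((P.continuousOn f).mono h1)).isClosed
  -- A neighbourhood of `v`: on a half-side, only points close to a corner over `v` map into it, and
  -- they lie in the neighbourhood chosen for that very corner. Interior points over it lie in `O₁`
  -- or `O₂`.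
  let W : Set S := ((⋃ s, P.toSurface (P.face s) '' (P.point s '' B s)) ∪
    (⋃ s, P.toSurface (P.face s) '' (P.point (P.next s) '' B' s)) ∪
    ⋃ f, P.toSurface f '' (closedBall 0 1 \ (O₁ f ∪ O₂ f)))ᶜ
  have hWopen : IsOpen W := by
    refine IsClosed.isOpen_compl (self := IsClosed.union (IsClosed.union ?_ ?_) ?_)
    · refine isClosed_iUnion_of_finite fun s => himg _ _ ?_ ((hB s).image (P.continuous_point s))
      rintro _ ⟨u, -, rfl⟩
      exact P.point_mem _ _
    · refine isClosed_iUnion_of_finite fun s => himg _ _ ?_ ((hB' s).image (P.continuous_point _))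
      rintro _ ⟨u, -, rfl⟩
      exact P.point_mem _ _
    · exact isClosed_iUnion_of_finite fun f => himg _ _ sdiff_subset
        ((isCompact_closedBall _ _).diff ((hO₁ f).union (hO₂ f)))
  have hdisj' : ∀ f z, z ∈ O₁ f → z ∉ O₂ f := fun f z h1 h2 => (hdisj f).le_bot ⟨h1, h2⟩
  have hOsub : ∀ s, O s ⊆ O₁ (P.face s) ∪ O₂ (P.face s) := by
    intro s
    simp only [O]
    split_ifs
    · exact subset_union_left
    · exact subset_union_right
  have hWB : ∀ x ∈ W, ∀ s, ∀ u ∈ Icc (1 / 2 : ℝ) 1, dirArc a b s u = x →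
      dirArc a b s 1 = v ∧ P.point s u ∈ O s := by
    intro x hx s u hu hux
    by_contra hc
    refine hx (Or.inl (Or.inl (mem_iUnion.2 ⟨s, _, ⟨u, ⟨hu, ?_⟩, rfl⟩, ?_⟩)))
    · exact fun h1 h2 => hc ⟨h1, h2⟩
    · rw [P.toSurface_point s ⟨by linarith [hu.1], hu.2⟩, hux]
  have hWB' : ∀ x ∈ W, ∀ s, ∀ u ∈ Icc (0 : ℝ) (1 / 2), dirArc a b (P.next s) u = x →
      dirArc a b s 1 = v → P.point (P.next s) u ∈ O s := by
    intro x hx s u hu hux h1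
    by_contra hc
    refine hx (Or.inl (Or.inr (mem_iUnion.2 ⟨s, _, ⟨u, ⟨hu, fun _ => hc⟩, rfl⟩, ?_⟩)))
    rw [← P.face_next s, P.toSurface_point _ ⟨hu.1, by linarith [hu.2]⟩, hux]
  have hvW : v ∈ W := by
    rintro ((h | h) | h)
    · obtain ⟨s, _, ⟨u, hu, rfl⟩, h⟩ := mem_iUnion.1 h
      rw [P.toSurface_point s (hBI s u hu)] at h
      have h1 := (dirArc_mem_inter_iff a b s (hBI s u hu)).1 (h ▸ hv)
      obtain rfl : u = 1 := h1.resolve_left (by linarith [hu.1.1])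
      exact hu.2 h (hcorner s h)
    · obtain ⟨s, _, ⟨u, hu, rfl⟩, h⟩ := mem_iUnion.1 h
      rw [← P.face_next s, P.toSurface_point _ (hBI' s u hu)] at h
      have h1 := (dirArc_mem_inter_iff a b _ (hBI' s u hu)).1 (h ▸ hv)
      obtain rfl : u = 0 := h1.resolve_right (by linarith [hu.1.2])
      rw [P.dirArc_next_zero] at h
      refine hu.2 h ?_
      rw [P.point_next_zero]
      exact hcorner s h
    · obtain ⟨f, z, hz, h⟩ := mem_iUnion.1 h
      obtain ⟨t, rfl, u, hu, rfl⟩ := P.exists_point_eq f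
        (P.norm_eq_one_of_mem f hz.1 (h ▸ Or.inl hv.1))
      rw [P.toSurface_point t hu] at h
      rcases (dirArc_mem_inter_iff a b t hu).1 (h ▸ hv) with rfl | rfl
      · obtain ⟨s, rfl⟩ := P.next.surjective t
        rw [P.dirArc_next_zero] at h
        rw [P.point_next_zero, P.face_next] at hz
        exact hz.2 (hOsub s (hcorner s h))
      · exact hz.2 (hOsub t (hcorner t h))
  -- The points of the surface all of whose preimages lie in `O`. Compactness of the discs makes
  -- this set open when `O` is.
  let U : (Fin P.num → Set ℂ) → Set S := fun O => (⋃ f, P.toSurface f '' (closedBall 0 1 \ O f))ᶜ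
  have hU : ∀ O, (∀ f, IsOpen (O f)) → IsOpen (U O) := fun O hO =>
    IsClosed.isOpen_compl (self := isClosed_iUnion_of_finite fun f => himg _ _ sdiff_subset
      ((isCompact_closedBall _ _).diff (hO f)))
  have hmemU : ∀ O x, (∀ f, ∀ z ∈ closedBall (0 : ℂ) 1, P.toSurface f z = x → z ∈ O f) →
      x ∈ U O := by
    intro O x h hx
    obtain ⟨f, z, hz, hzx⟩ := mem_iUnion.1 hx
    exact hz.2 (h f z hz.1 hzx)
  have hmemU' : ∀ O : Fin P.num → Set ℂ, ∀ f, ∀ z ∈ ball (0 : ℂ) 1, z ∈ O f →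
      P.toSurface f z ∈ U O := by
    intro O f z hz hzO
    refine hmemU _ _ fun f' z' hz' h => ?_
    obtain ⟨rfl, rfl⟩ := P.eq_of_toSurface_eq hz hz' h
    exact hzO
  have hcover : ∀ x ∈ W, x ≠ v → x ∈ U O₁ ∪ U O₂ := by
    intro x hxW hxv
    by_cases hx : x ∈ range α ∪ range β
    -- Every point of the curves lies on the second half of an arc in one of its two directions.
    · obtain ⟨s, u, hu, hu2, rfl⟩ : ∃ s, ∃ u ∈ I, 1 / 2 ≤ u ∧ dirArc a b s u = x := by
        obtain ⟨s, u, hu, h⟩ := exists_dirArc_eq a b hx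
        rcases le_total (1 / 2) u with h1 | h1
        · exact ⟨s, u, hu, h1, h⟩
        · refine ⟨s.inv, 1 - u, one_sub_mem hu, by linarith, ?_⟩
          rw [dirArc_inv, sub_sub_cancel, h]
      obtain ⟨hs1, hsO⟩ := hWB _ hxW s u ⟨hu2, hu.2⟩ rfl
      have hu1 : u ≠ 1 := by
        rintro rfl
        exact hxv hs1
      -- The other preimage lies on the side labelled `s.inv`, next to the corner where `r` ends.
      -- Since `s` is the image of `r` under the rotation, `r` and `s` are both in `A` or both
      -- outside, and the two preimages lie in neighbourhoods of the same kind.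
      obtain ⟨r, hr⟩ := P.next.surjective s.inv
      have hr1 : dirArc a b r 1 = v := by
        rw [← P.dirArc_next_zero, hr, dirArc_inv, sub_zero, hs1]
      have hrO := hWB' _ hxW r (1 - u) ⟨by linarith [hu.2], by linarith⟩
        (by rw [hr, dirArc_inv, sub_sub_cancel]) hr1
      have hrs : r ∈ A ↔ s ∈ A := by
        have h1 : (P.next r).inv = s := by rw [hr, Symbol.inv_inv]
        exact ⟨fun h => h1 ▸ hinv r h, fun h => hinv' r (h1 ▸ h)⟩
      have hrf : P.face r = P.face s.inv := by rw [← hr, P.face_next]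
      rw [hr] at hrO
      simp only [O, hrs, hrf] at hrO hsO
      by_cases hsA : s ∈ A
      · rw [if_pos hsA] at hrO hsO
        refine Or.inl (hmemU _ _ fun f z hz h => ?_)
        rcases P.eq_point_of_toSurface_eq hα hβ hu (by linarith) hu1 hz h with ⟨rfl, rfl⟩ | ⟨rfl, rfl⟩
        · exact hsO
        · exact hrO
      · rw [if_neg hsA] at hrO hsO
        refine Or.inr (hmemU _ _ fun f z hz h => ?_)
        rcases P.eq_point_of_toSurface_eq hα hβ hu (by linarith) hu1 hz h with ⟨rfl, rfl⟩ | ⟨rfl, rfl⟩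
        · exact hsO
        · exact hrO
    · obtain ⟨⟨f, z⟩, ⟨hz, rfl⟩, -⟩ := P.interior_bijective x hx
      have : z ∈ O₁ f ∪ O₂ f := by
        by_contra hc
        exact hxW (Or.inr (mem_iUnion.2 ⟨f, z, ⟨ball_subset_closedBall hz, hc⟩, rfl⟩))
      exact this.imp (hmemU' _ f z hz) (hmemU' _ f z hz)
  obtain ⟨h, hh, h0, hhW⟩ := exists_isOpenEmbedding_plane (hWopen.mem_nhds hvW)
  have hpre := isPreconnected_range_diff hh
  rw [h0] at hpre
  -- A corner over `v` is a limit of interior points of its polygon. These map close to `v`, avoid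
  -- `v`, and have no other preimage.
  have hmeets : ∀ (Q : Fin P.num → Set ℂ), (∀ f, IsOpen (Q f)) → ∀ s, dirArc a b s 1 = v →
      P.point s 1 ∈ Q (P.face s) → ((range h \ {v}) ∩ U Q).Nonempty := by
    intro Q hQ s hs hsQ
    have h1 : ∀ᶠ z in 𝓝[closedBall 0 1] (P.point s 1), P.toSurface (P.face s) z ∈ range h := by
      refine (P.continuousOn (P.face s) _ (P.point_mem s 1)) ?_
      rw [P.toSurface_point s (by simp), hs]
      exact hh.isOpen_range.mem_nhds ⟨0, h0⟩
    have h2 : ∀ᶠ z in 𝓝[ball 0 1] (P.point s 1), P.toSurface (P.face s) z ∈ range h ∧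
        z ∈ Q (P.face s) ∧ z ∈ ball (0 : ℂ) 1 :=
      (h1.filter_mono (nhdsWithin_mono _ ball_subset_closedBall)).and
        (Eventually.and (mem_nhdsWithin_of_mem_nhds ((hQ _).mem_nhds hsQ)) self_mem_nhdsWithin)
    have : (𝓝[ball 0 1] (P.point s 1)).NeBot := by
      rw [← mem_closure_iff_nhdsWithin_neBot, closure_ball _ one_ne_zero]
      exact P.point_mem s 1
    obtain ⟨z, hz1, hz2, hz3⟩ := h2.exists
    refine ⟨P.toSurface (P.face s) z, ⟨hz1, fun hzv => ?_⟩, hmemU' _ _ z hz3 hz2⟩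
    exact P.interior_notMem _ z hz3 (by rw [hzv]; exact Or.inl hv.1)
  obtain ⟨t, ht⟩ := hne
  obtain ⟨x, -, hx1, hx2⟩ := hpre (U O₁) (U O₂) (hU _ hO₁) (hU _ hO₂)
    (fun x hx => hcover x (hhW hx.1) hx.2)
    (hmeets O₁ hO₁ t (hA t ht) (hC₁ _ ⟨t, ht, rfl, rfl⟩))
    (hmeets O₂ hO₂ s hs (hC₂ _ ⟨s, hsA, hs, rfl, rfl⟩))
  obtain ⟨f, z, hz, rfl⟩ := P.exists_toSurface_eq x
  have hz1 : z ∈ O₁ f := by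
    by_contra hc
    exact hx1 (mem_iUnion.2 ⟨f, z, ⟨hz, hc⟩, rfl⟩)
  have hz2 : z ∈ O₂ f := by
    by_contra hc
    exact hx2 (mem_iUnion.2 ⟨f, z, ⟨hz, hc⟩, rfl⟩)
  exact hdisj' f z hz1 hz2

end CutPolygons

/-! ### Minimal position and crossings. -/

namespace CutPolygons

variable {α β : C(UnitAddCircle, S)} {g : ℕ} {a : Labelling α β (2 * g)} {b : Labelling β α (2 * g)}
  (P : CutPolygons a b)

/-- Curves in minimal position do not have an intersection point on a stretch of `α` which runs
along the boundary of a polygon: replacing this stretch by a chord of the polygon would remove the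
intersection point. -/
theorem not_minimal_of_boundary_path (hα : IsSimpleClosed α) (hmin : InMinimalPosition α β)
    (hfin : (range α ∩ range β).Finite) (f : Fin P.num) {c : ℝ → ℂ} {x y v : ℝ}
    (hyx : y < x + 1) (hc : ContinuousOn c (Icc x y)) (hcD : ∀ t ∈ Icc x y, c t ∈ closedBall 0 1)
    (hcα : ∀ t ∈ Icc x y, P.toSurface f (c t) = α (t : UnitAddCircle))
    (hv : v ∈ Ioo x y) (hvβ : α (v : UnitAddCircle) ∈ range β) : False := by
  have hxy : x < y := hv.1.trans hv.2
  have hxI : x ∈ Icc x y := ⟨le_rfl, hxy.le⟩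
  have hyI : y ∈ Icc x y := ⟨hxy.le, le_rfl⟩
  have hαinj : ∀ t ∈ Ico x (x + 1), ∀ t' ∈ Ico x (x + 1),
      α (t : UnitAddCircle) = α (t' : UnitAddCircle) → t = t' := fun t ht t' ht' h =>
    (AddCircle.coe_eq_coe_iff_of_mem_Ico ht ht').1 (hα h)
  have hne : c x ≠ c y := by
    intro h
    have := hαinj x ⟨le_rfl, by linarith⟩ y ⟨hxy.le, hyx⟩ (by rw [← hcα x hxI, ← hcα y hyI, h])
    exact hxy.ne this
  let π : ℝ → ℝ := fun t => projIcc x y hxy.le t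
  have hπc : Continuous π := continuous_subtype_val.comp continuous_projIcc
  have hπI : ∀ t, π t ∈ Icc x y := fun t => (projIcc x y hxy.le t).2
  have hπ : ∀ t ∈ Icc x y, π t = t := fun t ht => by simp only [π, projIcc_of_mem hxy.le ht]
  -- By strict convexity the open chord lies inside the disc, so its image misses both curves.
  let chord : ℝ → ℂ := fun t => AffineMap.lineMap (c x) (c y) ((t - x) / (y - x))
  have hchordx : chord x = c x := by simp [chord]
  have hchordy : chord y = c y := by simp [chord, div_self (sub_pos.2 hxy).ne']
  have hparam : ∀ t ∈ Icc x y, (t - x) / (y - x) ∈ Icc (0 : ℝ) 1 := fun t ht =>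
    ⟨div_nonneg (by linarith [ht.1]) (by linarith),
      (div_le_one (by linarith)).2 (by linarith [ht.2])⟩
  have hchordD : ∀ t ∈ Icc x y, chord t ∈ closedBall (0 : ℂ) 1 := fun t ht =>
    (convex_closedBall (0 : ℂ) 1).lineMap_mem (hcD x hxI) (hcD y hyI) (hparam t ht)
  have hchordB : ∀ t ∈ Ioo x y, chord t ∈ ball (0 : ℂ) 1 := by
    intro t ht
    have h1 : (t - x) / (y - x) ∈ Ioo (0 : ℝ) 1 :=
      ⟨div_pos (by linarith [ht.1]) (by linarith), (div_lt_one (by linarith)).2 (by linarith [ht.2])⟩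
    have h2 := (strictConvex_closedBall ℝ (0 : ℂ) 1).openSegment_subset (hcD x hxI) (hcD y hyI) hne
    rw [interior_closedBall _ one_ne_zero] at h2
    refine h2 ?_
    rw [openSegment_eq_image_lineMap]
    exact ⟨_, h1, rfl⟩
  have hchord_inj : ∀ t t', chord t = chord t' → t = t' := by
    intro t t' h
    have h1 := AffineMap.lineMap_injective ℝ hne h
    field_simp [(sub_pos.2 hxy).ne'] at h1
    linarith
  have hLcont : Continuous fun p : ℝ × I =>
      P.toSurface f (AffineMap.lineMap (c (π p.1)) (chord (π p.1)) (p.2 : ℝ)) := by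
    refine (P.continuousOn f).comp_continuous ?_ fun p =>
      (convex_closedBall (0 : ℂ) 1).lineMap_mem (hcD _ (hπI _)) (hchordD _ (hπI _)) p.2.2
    have h1 : Continuous fun p : ℝ × I => c (π p.1) :=
      (hc.comp_continuous hπc hπI).comp continuous_fst
    have h2 : Continuous fun p : ℝ × I => chord (π p.1) := by
      simp only [chord, AffineMap.lineMap_apply]
      have := hπc.comp (continuous_fst (X := ℝ) (Y := I))
      simp only [Function.comp_def] at this
      fun_prop
    simp only [AffineMap.lineMap_apply, vsub_eq_sub, vadd_eq_add]
    exact ((continuous_subtype_val.comp continuous_snd).smul (h2.sub h1)).add h1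
  let G₁ : C(ℝ, C(I, S)) := ContinuousMap.curry ⟨_, hLcont⟩
  -- The straight-line homotopy from the boundary stretch to the chord, extended by the constant
  -- homotopy to the rest of the period. As a map into a space of paths it descends to the circle by
  -- a one-variable lifting lemma.
  let G : ℝ → C(I, S) := fun t => if t ≤ y then G₁ t else .const _ (α (t : UnitAddCircle))
  have hG₁ : ∀ t s, G₁ t s =
      P.toSurface f (AffineMap.lineMap (c (π t)) (chord (π t)) (s : ℝ)) := fun t s => rfl
  have hGcont : Continuous G := by
    refine Continuous.if_le G₁.continuous ?_ continuous_id continuous_const ?_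
    · exact ContinuousMap.continuous_const'.comp (α.continuous.comp (AddCircle.continuous_mk' 1))
    · rintro t rfl
      ext s
      rw [hG₁, hπ _ hyI, hchordy, AffineMap.lineMap_same_apply, hcα _ hyI]
      rfl
  have hGx : G x = G (x + 1) := by
    ext s
    simp only [G, if_pos hxy.le, if_neg (not_le.2 hyx)]
    rw [hG₁, hπ _ hxI, hchordx, AffineMap.lineMap_same_apply, hcα _ hxI]
    simp
  let H : UnitAddCircle → C(I, S) := AddCircle.liftIco 1 x G
  have hH : Continuous H := AddCircle.liftIco_continuous hGx hGcont.continuousOn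
  have hHt : ∀ t ∈ Ico x (x + 1), H (t : UnitAddCircle) = G t := fun t ht =>
    AddCircle.liftIco_coe_apply ht
  have hrep : ∀ p : UnitAddCircle, ∃ t ∈ Ico x (x + 1), (t : UnitAddCircle) = p := fun p => by
    have : p ∈ ((↑) : ℝ → UnitAddCircle) '' Ico x (x + 1) := by
      rw [AddCircle.coe_image_Ico_eq]; trivial
    exact this
  let α' : C(UnitAddCircle, S) := ⟨fun p => H p 1, hH.eval_const 1⟩
  have hα' : ∀ t ∈ Ico x (x + 1), (t ∈ Ioo x y ∧ α' (t : UnitAddCircle) = P.toSurface f (chord t)) ∨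
      (t ∉ Ioo x y ∧ α' (t : UnitAddCircle) = α (t : UnitAddCircle)) := by
    intro t ht
    have h1 : α' (t : UnitAddCircle) = G t 1 := by rw [← hHt t ht]; rfl
    by_cases hty : t ≤ y
    · have htI : t ∈ Icc x y := ⟨ht.1, hty⟩
      have h2 : α' (t : UnitAddCircle) = P.toSurface f (chord t) := by
        rw [h1]
        simp only [G, if_pos hty, hG₁, hπ t htI]
        simp
      by_cases hto : t ∈ Ioo x y
      · exact Or.inl ⟨hto, h2⟩
      · refine Or.inr ⟨hto, ?_⟩
        have h3 : t = x ∨ t = y := by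
          by_contra hcon
          rw [not_or] at hcon
          exact hto ⟨lt_of_le_of_ne ht.1 (Ne.symm hcon.1), lt_of_le_of_ne hty hcon.2⟩
        rcases h3 with rfl | rfl
        · rw [h2, hchordx, hcα _ hxI]
        · rw [h2, hchordy, hcα _ hyI]
    · refine Or.inr ⟨fun h => hty h.2.le, ?_⟩
      rw [h1]
      simp only [G, if_neg hty]
      rfl
  have hnot : ∀ t ∈ Ioo x y, P.toSurface f (chord t) ∉ range α ∪ range β := fun t ht =>
    P.interior_notMem f _ (hchordB t ht)
  have hsimple : IsSimpleClosed α' := by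
    intro p p' hpp
    obtain ⟨t, ht, rfl⟩ := hrep p
    obtain ⟨t', ht', rfl⟩ := hrep p'
    congr 1
    rcases hα' t ht with ⟨h1, h2⟩ | ⟨h1, h2⟩ <;> rcases hα' t' ht' with ⟨h3, h4⟩ | ⟨h3, h4⟩ <;>
      rw [h2, h4] at hpp
    · exact hchord_inj _ _ (P.eq_of_toSurface_eq (hchordB t' h3)
        (ball_subset_closedBall (hchordB t h1)) hpp).2
    · exact absurd (Or.inl ⟨_, hpp.symm⟩) (hnot t h1)
    · exact absurd (Or.inl ⟨_, hpp⟩) (hnot t' h3)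
    · exact hαinj t ht t' ht' hpp
  have hhom : α'.Homotopic α := by
    refine ContinuousMap.Homotopic.symm ⟨⟨⟨fun p => H p.2 p.1, ?_⟩, fun p => ?_, fun p => rfl⟩⟩
    · exact (hH.comp continuous_snd).eval continuous_fst
    · obtain ⟨t, ht, rfl⟩ := hrep p
      change H _ 0 = _
      rw [hHt t ht]
      simp only [G]
      split_ifs with hty
      · rw [hG₁, hπ t ⟨ht.1, hty⟩]
        simp [hcα t ⟨ht.1, hty⟩]
      · rfl
  have hvI : v ∈ Ico x (x + 1) := ⟨hv.1.le, hv.2.trans hyx⟩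
  -- The chord adds no intersection point, and the point with parameter `v` is lost because α passes
  -- through it only once.
  have hss : range α' ∩ range β ⊂ range α ∩ range β := by
    have key : ∀ q ∈ range α' ∩ range β, q ∈ range α ∩ range β ∧ q ≠ α (v : UnitAddCircle) := by
      rintro q ⟨⟨p, rfl⟩, hqβ⟩
      obtain ⟨t, ht, rfl⟩ := hrep p
      rcases hα' t ht with ⟨h1, h2⟩ | ⟨h1, h2⟩
      · rw [h2] at hqβ
        exact absurd (Or.inr hqβ) (hnot t h1)
      · rw [h2] at hqβ ⊢
        refine ⟨⟨⟨_, rfl⟩, hqβ⟩, fun h => h1 ?_⟩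
        rw [hαinj t ht v hvI h]
        exact hv
    refine ⟨fun q hq => (key q hq).1, fun h => ?_⟩
    exact (key _ (h ⟨⟨_, rfl⟩, hvβ⟩)).2 rfl
  have hlt := (hfin.subset hss.1).encard_lt_encard hss
  have hle : geomInter α β ≤ (range α' ∩ range β).encard :=
    iInf₂_le α' (show α' ∈ {α' | IsSimpleClosed α' ∧ α'.Homotopic α} from ⟨hsimple, hhom⟩)
  rw [hmin] at hlt
  exact absurd hle (not_le.2 hlt)

/-- The two sides enter as arbitrary parametrised curves in one disc, so that a corner traversed
against α is covered after reversing the parameters. -/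
theorem not_minimal_of_corner [NeZero g] (hα : IsSimpleClosed α) (hmin : InMinimalPosition α β)
    (hfin : (range α ∩ range β).Finite) (f : Fin P.num) {e₁ e₂ : ℝ → ℂ} {i : ℤ}
    (hc₁ : Continuous e₁) (hc₂ : Continuous e₂)
    (hD₁ : ∀ u, e₁ u ∈ closedBall 0 1) (hD₂ : ∀ u, e₂ u ∈ closedBall 0 1)
    (h₁ : ∀ u ∈ I, P.toSurface f (e₁ u) = a.arc i u)
    (h₂ : ∀ u ∈ I, P.toSurface f (e₂ u) = a.arc (i + 1) u) (he : e₁ 1 = e₂ 0) : False := by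
  have hg := NeZero.pos g
  have hd₁ := sub_pos.2 (a.pt_lt_succ i)
  have hd₂ := sub_pos.2 (a.pt_lt_succ (i + 1))
  let r₁ : ℝ → ℝ := fun t => (t - a.pt i) / (a.pt (i + 1) - a.pt i)
  let r₂ : ℝ → ℝ := fun t => (t - a.pt (i + 1)) / (a.pt (i + 1 + 1) - a.pt (i + 1))
  have hr₁ : ∀ t, a.pos i (r₁ t) = t := fun t => by simp only [Labelling.pos, r₁]; field_simp; ring
  have hr₂ : ∀ t, a.pos (i + 1) (r₂ t) = t := fun t => by
    simp only [Labelling.pos, r₂]; field_simp; ring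
  have hx : a.pos i (1 / 2) < a.pt (i + 1) := by
    rw [← a.pos_one]; exact a.pos_strictMono i (by norm_num)
  have hy : a.pt (i + 1) < a.pos (i + 1) (1 / 2) := by
    rw [← a.pos_zero]; exact a.pos_strictMono _ (by norm_num)
  have hx' : a.pt i < a.pos i (1 / 2) := by
    rw [← a.pos_zero]; exact a.pos_strictMono _ (by norm_num)
  have hy' : a.pos (i + 1) (1 / 2) < a.pt (i + 1 + 1) := by
    rw [← a.pos_one]; exact a.pos_strictMono _ (by norm_num)
  have hper : a.pt (i + 1 + 1) ≤ a.pt i + 1 := by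
    rw [← a.periodic]; exact a.strictMono.monotone (by push_cast; omega)
  -- The stretch runs between the midpoints of the two arcs. For `g = 1` the two whole arcs make up
  -- all of α, whereas the stretch must be shorter than a period.
  refine P.not_minimal_of_boundary_path hα hmin hfin f
    (c := fun t => if t ≤ a.pt (i + 1) then e₁ (r₁ t) else e₂ (r₂ t)) (x := a.pos i (1 / 2))
    (y := a.pos (i + 1) (1 / 2)) (v := a.pt (i + 1)) (by linarith) ?_ ?_ ?_ ⟨hx, hy⟩
    ((a.meets_iff _).2 ⟨_, rfl⟩)
  · refine (Continuous.if_le (hc₁.comp ?_) (hc₂.comp ?_) continuous_id continuous_const ?_).continuousOn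
    · fun_prop
    · fun_prop
    · rintro t rfl
      simp only [r₁, r₂, Function.comp, sub_self, zero_div, div_self hd₁.ne', he]
  · intro t _
    split_ifs
    · exact hD₁ _
    · exact hD₂ _
  · intro t ht
    split_ifs with h
    · rw [h₁, Labelling.arc_eq_pos, hr₁]
      exact ⟨div_nonneg (by linarith [ht.1]) hd₁.le, (div_le_one hd₁).2 (by linarith)⟩
    · rw [h₂, Labelling.arc_eq_pos, hr₂]
      exact ⟨div_nonneg (by linarith) hd₂.le, (div_le_one hd₂).2 (by linarith [ht.2])⟩

/-- In minimal position no polygon has two consecutive sides which are consecutive arcs of `α`. -/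
theorem next_ne_succ [NeZero g] (hα : IsSimpleClosed α) (hmin : InMinimalPosition α β)
    (hfin : (range α ∩ range β).Finite) {s : Symbol g} (hs : s.IsAlpha) : P.next s ≠ s.succ := by
  intro hnext
  have harc : ∀ (i : Fin (2 * g)) u,
      a.arc ((finRotate _ i : Fin (2 * g)) : ℕ) u = a.arc ((i : ℕ) + 1 : ℤ) u := by
    intro i u
    rw [finRotate_val_emod]
    have h1 := a.arc_add_mul (((i : ℕ) + 1 : ℤ) % (2 * g : ℕ)) (((i : ℕ) + 1 : ℤ) / (2 * g : ℕ)) u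
    rw [Int.emod_add_mul_ediv] at h1
    exact h1.symm
  have hf := P.face_next s
  have h0 := P.point_next_zero s
  have h1 := fun u hu => P.toSurface_point s (u := u) hu
  have h2 := fun u hu => P.toSurface_point (P.next s) (u := u) hu
  rw [hf] at h2
  cases s with
  | alpha i =>
    refine P.not_minimal_of_corner hα hmin hfin _ (P.continuous_point (.alpha i))
      (P.continuous_point (P.next (.alpha i))) (P.point_mem _) (P.point_mem _) h1 ?_ h0.symm
    intro u hu
    rw [h2 u hu, hnext]
    exact harc i u
  | alphaInv k =>
    -- Here α is traversed backwards, so the later side carries the earlier arc `i`: the sides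
    -- change places and both parameters are reversed.
    obtain ⟨i, rfl⟩ := (finRotate (2 * g)).surjective k
    have hsub : Continuous fun u : ℝ => 1 - u := by fun_prop
    refine P.not_minimal_of_corner hα hmin hfin (P.face (.alphaInv (finRotate _ i)))
      ((P.continuous_point (P.next (.alphaInv (finRotate _ i)))).comp hsub)
      ((P.continuous_point (.alphaInv (finRotate _ i))).comp hsub) (i := (i : ℕ))
      (fun u => P.point_mem _ _) (fun u => P.point_mem _ _) ?_ ?_ ?_
    · intro u hu
      refine (h2 _ (one_sub_mem hu)).trans ?_
      rw [hnext]
      simp [Symbol.succ, dirArc]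
    · intro u hu
      refine (h1 _ (one_sub_mem hu)).trans ?_
      simp only [dirArc, sub_sub_cancel]
      exact harc i u
    · simp only [Function.comp, sub_self, sub_zero, h0]
  | beta i => exact hs.elim
  | betaInv i => exact hs.elim

end CutPolygons

/-- The two arcs of one curve ending at a vertex are `s` and `s.succ.inv`. Each continues straight
on as the reversal of the other. -/
theorem Symbol.succ_inv_succ {g : ℕ} (s : Symbol g) : s.succ.inv.succ = s.inv := by
  cases s <;> simp only [succ, inv, Equiv.symm_apply_apply, Equiv.apply_symm_apply]

/-- The only cyclic arrangements of four elements `A, A', B, B'` in which `A` and `A'` are not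
neighbours. -/
theorem alternating_of_transitive {X : Type*} {ψ : X → X} (hψ : Function.Injective ψ)
    {A A' B B' : X} (hAA : A ≠ A') (hAB : A ≠ B) (hAB' : A ≠ B') (hA'B : A' ≠ B) (hA'B' : A' ≠ B')
    (hBB : B ≠ B')
    (hmaps : ∀ x, (x = A ∨ x = A' ∨ x = B ∨ x = B') →
      (ψ x = A ∨ ψ x = A' ∨ ψ x = B ∨ ψ x = B'))
    (htrans : ∀ T : Set X, A ∈ T → A' ∉ T → T ⊆ {A, A', B, B'} → ¬ ∀ x ∈ T, ψ x ∈ T)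
    (h1 : ψ A ≠ A') (h2 : ψ A' ≠ A) :
    (ψ (ψ A) = A' ∧ ψ (ψ A') = A ∧ ψ (ψ B) = B' ∧ ψ (ψ B') = B) ∧
      (ψ A = B ∨ ψ A = B') ∧ (ψ A' = B ∨ ψ A' = B') ∧ (ψ B = A ∨ ψ B = A') ∧
      (ψ B' = A ∨ ψ B' = A') := by
  -- Invariant sets containing `A` must contain `A'`, which excludes short orbits of `A`. The only
  -- remaining alternative to the alternating cycle is A, C, D, A' with {C, D} = {B, B'}, and it
  -- would force ψ A' = A by injectivity.
  have e1 : ψ A ≠ A := by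
    intro h
    refine htrans {A} (by simp) (by simp [hAA.symm]) (by simp) (by simp [h])
  have e2 : ∀ C, C = B ∨ C = B' → ψ A = C → ψ C ≠ A := by
    intro C hC h h'
    refine htrans {A, C} (by simp) ?_ ?_ (by simp [h, h'])
    · rcases hC with rfl | rfl <;> simp [hAA.symm, hA'B, hA'B']
    · rcases hC with rfl | rfl <;> simp [insert_subset_iff]
  have e3 : ∀ C D, C = B ∧ D = B' ∨ C = B' ∧ D = B → ψ A = C → ψ C = D → ψ D ≠ A := by
    intro C D hC h h' h''
    refine htrans {A, C, D} (by simp) ?_ ?_ (by simp [h, h', h''])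
    · rcases hC with ⟨rfl, rfl⟩ | ⟨rfl, rfl⟩ <;> simp [hAA.symm, hA'B, hA'B']
    · rcases hC with ⟨rfl, rfl⟩ | ⟨rfl, rfl⟩ <;> simp [insert_subset_iff]
  have m1 := hmaps A (by simp)
  have m2 := hmaps A' (by simp)
  have m3 := hmaps B (by simp)
  have m4 := hmaps B' (by simp)
  have e2B := e2 B (Or.inl rfl)
  have e2B' := e2 B' (Or.inr rfl)
  have e3B := e3 B B' (Or.inl ⟨rfl, rfl⟩)
  have e3B' := e3 B' B (Or.inr ⟨rfl, rfl⟩)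
  have i1 := fun h => hAA (hψ (a₁ := A) (a₂ := A') h)
  have i2 := fun h => hAB (hψ (a₁ := A) (a₂ := B) h)
  have i3 := fun h => hAB' (hψ (a₁ := A) (a₂ := B') h)
  have i4 := fun h => hA'B (hψ (a₁ := A') (a₂ := B) h)
  have i5 := fun h => hA'B' (hψ (a₁ := A') (a₂ := B') h)
  have i6 := fun h => hBB (hψ (a₁ := B) (a₂ := B') h)
  grind

namespace CutPolygons

variable {α β : C(UnitAddCircle, S)} {g : ℕ} {a : Labelling α β (2 * g)} {b : Labelling β α (2 * g)}
  (P : CutPolygons a b)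

/-- The curves cross at each point of intersection: an arc is followed by the arc which is opposite
at its end point, and sides on `α` and sides on `β` alternate. -/
theorem next_inv_next_and_isAlpha_next [NeZero g] [T2Space S] [ChartedSpace (EuclideanSpace ℝ (Fin 2)) S]
    (hα : IsSimpleClosed α) (hβ : IsSimpleClosed β) (hmin : InMinimalPosition α β)
    (hfin : (range α ∩ range β).Finite) (s : Symbol g) :
    P.next (P.next s).inv = s.succ ∧ ((P.next s).IsAlpha ↔ ¬ s.IsAlpha) := by
  have hv : dirArc a b s 1 ∈ range α ∩ range β := by
    rw [dirArc_mem_inter_iff a b s (by simp)]; simp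
  obtain ⟨i, j, hij⟩ := exists_incoming a b hα hβ hv
  set v := dirArc a b s 1
  -- This map rotates about the end point: it takes a directed arc ending at `v` to a neighbouring
  -- one.
  have hψ : Function.Injective fun s => (P.next s).inv :=
    Symbol.inv_injective.comp P.next.injective
  have hterm : ∀ t, dirArc a b (P.next t).inv 1 = dirArc a b t 1 := fun t => by
    rw [dirArc_inv, sub_self, P.dirArc_next_zero]
  have key := alternating_of_transitive hψ (A := .alpha i) (A' := (Symbol.alpha i).succ.inv)
    (B := .beta j) (B' := (Symbol.beta j).succ.inv) (by simp [Symbol.succ]) (by simp)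
    (by simp [Symbol.succ]) (by simp [Symbol.succ]) (by simp [Symbol.succ]) (by simp [Symbol.succ])
    (fun x hx => by rw [← hij] at hx ⊢; rw [hterm, hx])
    (fun T hT hT' hsub hinv => hT' (P.mem_of_invariant hα hβ
      (fun t ht => (hij t).2 (hsub ht)) ⟨_, hT⟩ hinv ((hij _).2 (by simp))))
    (fun h => P.next_ne_succ hα hmin hfin (s := .alpha i) (by simp) (Symbol.inv_injective h))
    (fun h => P.next_ne_succ hα hmin hfin (s := (Symbol.alpha i).succ.inv) (by simp [Symbol.succ])
      (by rw [Symbol.succ_inv_succ]; exact Symbol.inv_injective (by rw [h, Symbol.inv_inv])))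
  constructor
  · apply Symbol.inv_injective
    rcases (hij s).1 rfl with h | h | h | h <;> rw [h]
    · exact key.1.1
    · rw [Symbol.succ_inv_succ, Symbol.inv_inv]; exact key.1.2.1
    · exact key.1.2.2.1
    · rw [Symbol.succ_inv_succ, Symbol.inv_inv]; exact key.1.2.2.2
  · rw [← Symbol.isAlpha_inv]
    obtain ⟨-, k1, k2, k3, k4⟩ := key
    rcases (hij s).1 rfl with h | h | h | h <;> rw [h]
    · rcases k1 with k | k <;> simp [k, Symbol.succ]
    · rcases k2 with k | k <;> rw [k] <;> simp [Symbol.succ]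
    · rcases k3 with k | k <;> simp [k, Symbol.succ]
    · rcases k4 with k | k <;> rw [k] <;> simp [Symbol.succ]

end CutPolygons

/-! ### Additive homotopy invariants of paths -/

/-- A real invariant of paths which is additive under concatenation and invariant under homotopies
relative to the end points. -/
structure PathCocycle (S : Type*) [TopologicalSpace S] where
  toFun : C(I, S) → ℝ
  trans : ∀ {x y z : S} (γ : Path x y) (δ : Path y z),
    toFun (γ.trans δ).toContinuousMap = toFun γ.toContinuousMap + toFun δ.toContinuousMap
  homotopic : ∀ {x y : S} {γ δ : Path x y}, γ.Homotopic δ →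
    toFun γ.toContinuousMap = toFun δ.toContinuousMap

instance : ContractibleSpace (closedBall (0 : ℂ) 1) := contractibleSpace_closedBall zero_le_one

instance : ContractibleSpace I := (convex_Icc (0 : ℝ) 1).contractibleSpace ⟨0, by simp⟩

namespace PathCocycle

variable {Y Z : Type*} [TopologicalSpace Y] [TopologicalSpace Z] [SimplyConnectedSpace Y]
  [SimplyConnectedSpace Z]

/-- The value of the cocycle on the images of the paths in a simply connected space with the given
end points. -/
def between (R : PathCocycle S) (q : C(Y, S)) (y y' : Y) : ℝ :=
  R.toFun (q.comp (PathConnectedSpace.somePath y y').toContinuousMap)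

/-- In a simply connected space any two paths with the same ends are homotopic, so the chosen path
in `between` is immaterial. -/
theorem toFun_comp_path (R : PathCocycle S) (q : C(Y, S)) {y y' : Y} (γ : Path y y') :
    R.toFun (q.comp γ.toContinuousMap) = R.between q y y' :=
  R.homotopic ((SimplyConnectedSpace.paths_homotopic γ
    (PathConnectedSpace.somePath y y')).map q)

theorem toFun_comp (R : PathCocycle S) (q : C(Y, S)) (γ : C(I, Y)) :
    R.toFun (q.comp γ) = R.between q (γ 0) (γ 1) :=
  R.toFun_comp_path q (⟨γ, rfl, rfl⟩ : Path (γ 0) (γ 1))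

theorem between_add (R : PathCocycle S) (q : C(Y, S)) (x y z : Y) :
    R.between q x y + R.between q y z = R.between q x z := by
  have h := R.trans ((PathConnectedSpace.somePath x y).map q.continuous)
    ((PathConnectedSpace.somePath y z).map q.continuous)
  rw [← Path.map_trans] at h
  rw [← R.toFun_comp_path q ((PathConnectedSpace.somePath x y).trans
    (PathConnectedSpace.somePath y z))]
  exact h.symm

theorem between_self (R : PathCocycle S) (q : C(Y, S)) (x : Y) : R.between q x x = 0 := by
  have := R.between_add q x x x
  linarith

theorem between_comp (R : PathCocycle S) (q : C(Y, S)) (k : C(Z, Y)) (z z' : Z) :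
    R.between (q.comp k) z z' = R.between q (k z) (k z') :=
   R.toFun_comp_path q ((PathConnectedSpace.somePath z z').map k.continuous)

/-- The interval is itself simply connected, so `between γ` measures the cocycle on parts of `γ`. -/
theorem toFun_eq_between (R : PathCocycle S) (γ : C(I, S)) : R.toFun γ = R.between γ 0 1 :=
  R.toFun_comp γ (ContinuousMap.id I)

end PathCocycle

theorem eventually_exists_segment {E : Type*} [NormedAddCommGroup E] [NormedSpace ℝ E] {C : Set E}
    (hC : Convex ℝ C) (x₀ : C) {N : Set C} (hN : N ∈ 𝓝 x₀) :
    ∀ᶠ x in 𝓝 x₀, ∃ p : C(I, C), p 0 = x₀ ∧ p 1 = x ∧ ∀ t, p t ∈ N := by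
  obtain ⟨ε, hε, hball⟩ := Metric.mem_nhds_iff.1 hN
  filter_upwards [Metric.ball_mem_nhds x₀ hε] with x hx
  have hcont : Continuous fun t : I => AffineMap.lineMap (x₀ : E) (x : E) (t : ℝ) := by
    simp only [AffineMap.lineMap_apply, vsub_eq_sub, vadd_eq_add]
    fun_prop
  refine ⟨⟨fun t => ⟨AffineMap.lineMap (x₀ : E) (x : E) (t : ℝ),
    hC.lineMap_mem x₀.2 x.2 t.2⟩, by fun_prop⟩, ?_, ?_, fun t => hball ?_⟩
  · ext; simp
  · ext; simp
  · have h1 := (convex_ball (x₀ : E) ε).lineMap_mem (mem_ball_self hε)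
      (show (x : E) ∈ ball (x₀ : E) ε from hx) t.2
    exact h1

theorem exists_lift_of_isOpenEmbedding {E : Type*} [TopologicalSpace E] {h : C(E, S)}
    (hh : IsOpenEmbedding h) {c : C(I, S)} (hc : ∀ t, c t ∈ range h) :
    ∃ c' : C(I, E), h.comp c' = c := by
  choose c' hc' using hc
  refine ⟨⟨c', hh.isInducing.continuous_iff.2 ?_⟩, ?_⟩
  · rw [show h ∘ c' = c from funext hc']
    exact c.continuous
  · ext t
    exact hc' t

/-! ### Primitives of cocycles on the polygons and on the surface. -/

namespace CutPolygons

variable {α β : C(UnitAddCircle, S)} {g : ℕ} {a : Labelling α β (2 * g)} {b : Labelling β α (2 * g)}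
  (P : CutPolygons a b)

/-- The gluing map of a polygon on the closed disc. -/
def disc (f : Fin P.num) : C(closedBall (0 : ℂ) 1, S) :=
  ⟨fun z => P.toSurface f z, (P.continuousOn f).domRestrict⟩

/-- A cocycle which is given by the differences of a function on each polygon is so on the
surface. -/
theorem toFun_eq_sub_of_disc [NeZero g] [T2Space S] [ChartedSpace (EuclideanSpace ℝ (Fin 2)) S]
    (R : PathCocycle S) (F : S → ℝ)
    (hF : ∀ f z w, R.between (P.disc f) z w = F (P.disc f w) - F (P.disc f z)) (γ : C(I, S)) :
    R.toFun γ = F (γ 1) - F (γ 0) := by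
  have hloc : ∀ v : S, ∃ U ∈ 𝓝 v, ∀ c : C(I, S), (∀ t, c t ∈ U) →
      R.toFun c = F (c 1) - F (c 0) := by
    intro v
    obtain ⟨h, hh, hv, -⟩ := exists_isOpenEmbedding_plane (v := v) univ_mem
    -- The discrepancy between `F` and the primitive of the cocycle in the plane. `F` is not known
    -- to be continuous, so openness of the fibres is tested in the polygons: a short segment there
    -- lifts to the plane, and along it both functions change by the value of the cocycle.
    let k : EuclideanSpace ℝ (Fin 2) → ℝ := fun z => F (h z) - R.between h 0 z
    have hk : IsLocallyConstant k := by
      rw [IsLocallyConstant.iff_isOpen_fiber]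
      intro r
      have hopen : IsOpen (h '' (k ⁻¹' {r})) := by
        refine P.isOpen_of_preimage fun f z hz hzV => ?_
        obtain ⟨e, he, hez⟩ := hzV
        have hN : P.disc f ⁻¹' range h ∈ 𝓝 (⟨z, hz⟩ : closedBall (0 : ℂ) 1) :=
          (P.disc f).continuous.continuousAt (hh.isOpen_range.mem_nhds ⟨e, hez⟩)
        rw [nhdsWithin_eq_map_subtype_coe hz, eventually_map]
        filter_upwards [eventually_exists_segment (convex_closedBall (0 : ℂ) 1) _ hN] with w hw
        obtain ⟨p, h0, h1, hp⟩ := hw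
        obtain ⟨c', hc'⟩ := exists_lift_of_isOpenEmbedding hh (c := (P.disc f).comp p) hp
        have e0 : c' 0 = e := by
          apply hh.injective
          rw [hez, ← ContinuousMap.comp_apply, hc', ContinuousMap.comp_apply, h0]
          rfl
        have e1 : h (c' 1) = P.disc f w := by
          rw [← ContinuousMap.comp_apply, hc', ContinuousMap.comp_apply, h1]
        refine ⟨c' 1, ?_, e1⟩
        have r1 := R.toFun_comp h c'
        rw [hc', R.toFun_comp, hF, h0, h1, e0] at r1
        have r2 := R.between_add h 0 e (c' 1)
        have r3 : F (h e) - R.between h 0 e = r := he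
        have r4 : F (P.disc f ⟨z, hz⟩) = F (h e) := by rw [hez]; rfl
        change F (h (c' 1)) - R.between h 0 (c' 1) = r
        rw [e1]
        linarith
      rw [← preimage_image_eq (k ⁻¹' {r}) hh.injective]
      exact hopen.preimage h.continuous
    refine ⟨range h, hh.isOpen_range.mem_nhds ⟨0, hv⟩, fun c hc => ?_⟩
    obtain ⟨c', rfl⟩ := exists_lift_of_isOpenEmbedding hh hc
    have r1 : F (h (c' 0)) - R.between h 0 (c' 0) = F (h (c' 1)) - R.between h 0 (c' 1) :=
      hk.apply_eq_of_preconnectedSpace _ _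
    have r2 := R.between_add h 0 (c' 0) (c' 1)
    rw [R.toFun_comp]
    simp only [ContinuousMap.comp_apply]
    linarith
  -- The local statement is integrated along `γ` by local constancy on the connected interval,
  -- without subdividing the path.
  have hD : IsLocallyConstant fun t => F (γ t) - R.between γ 0 t := by
    rw [IsLocallyConstant.iff_eventually_eq]
    intro t₀
    obtain ⟨U, hU, hUR⟩ := hloc (γ t₀)
    have hN : γ ⁻¹' U ∈ 𝓝 t₀ := γ.continuous.continuousAt hU
    filter_upwards [eventually_exists_segment (convex_Icc (0 : ℝ) 1) t₀ hN] with t ht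
    obtain ⟨p, h0, h1, hp⟩ := ht
    have r1 := hUR (γ.comp p) hp
    rw [R.toFun_comp] at r1
    simp only [ContinuousMap.comp_apply, h0, h1] at r1
    have r2 := R.between_add γ 0 t₀ t
    linarith
  have r1 : F (γ 0) - R.between γ 0 0 = F (γ 1) - R.between γ 0 1 :=
    hD.apply_eq_of_preconnectedSpace _ _
  rw [R.between_self] at r1
  rw [R.toFun_eq_between]
  linarith

/-- A side of a polygon as a path in the disc. -/
def _root_.FillingPair.sideMap (n k : ℕ) : C(I, closedBall (0 : ℂ) 1) :=
  ⟨fun u => ⟨sidePoint n k u, sidePoint_mem n k u⟩,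
    ((continuous_sidePoint n k).comp continuous_subtype_val).subtype_mk _⟩

theorem _root_.FillingPair.sideMap_one (n k : ℕ) : sideMap n k 1 = sideMap n (k + 1) 0 :=
  Subtype.ext (sidePoint_one n k)

theorem disc_comp_sideMap (f : Fin P.num) (k : Fin (P.sides f)) :
    (P.disc f).comp (sideMap (P.sides f) k) = arcMap a b (P.label ⟨f, k⟩) := by
  ext u
  exact P.side_eq f k u u.2

theorem exists_sideMap_eq {n : ℕ} (hn : 0 < n) {z : closedBall (0 : ℂ) 1} (hz : ‖(z : ℂ)‖ = 1) :
    ∃ k : Fin n, ∃ u : I, sideMap n k u = z := by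
  obtain ⟨k, u, hu, h⟩ := exists_sidePoint_eq hn hz
  exact ⟨k, ⟨u, hu⟩, Subtype.ext h⟩

theorem _root_.FillingPair.arcMap_inv (s : Symbol g) :
    arcMap a b s.inv = (arcMap a b s).comp ⟨unitInterval.symm, unitInterval.continuous_symm⟩ := by
  ext u
  exact dirArc_inv a b s u

theorem _root_.FillingPair.toFun_arcMap_inv (R : PathCocycle S) (s : Symbol g) :
    R.toFun (arcMap a b s.inv) = -R.toFun (arcMap a b s) := by
  rw [arcMap_inv, R.toFun_comp, R.toFun_eq_between (arcMap a b s)]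
  have h1 := R.between_add (arcMap a b s) 0 1 0
  rw [R.between_self] at h1
  simp only [ContinuousMap.coe_mk, unitInterval.symm_zero, unitInterval.symm_one]
  linarith

/-- The values of a cocycle on the sides of a polygon add up to zero. -/
theorem sum_toFun_side (R : PathCocycle S) (f : Fin P.num) :
    ∑ k, R.toFun (arcMap a b (P.label ⟨f, k⟩)) = 0 := by
  have h1 : ∀ k : Fin (P.sides f), R.toFun (arcMap a b (P.label ⟨f, k⟩)) =
      R.between (P.disc f) (sideMap (P.sides f) k 0) (sideMap (P.sides f) (k + 1) 0) := by
    intro k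
    rw [← P.disc_comp_sideMap, R.toFun_comp, sideMap_one]
  simp only [h1]
  rw [Fin.sum_univ_eq_sum_range fun k => R.between (P.disc f) (sideMap (P.sides f) k 0)
    (sideMap (P.sides f) (k + 1) 0)]
  have h2 : ∀ m, ∑ k ∈ Finset.range m, R.between (P.disc f) (sideMap (P.sides f) k 0)
      (sideMap (P.sides f) (k + 1) 0) =
      R.between (P.disc f) (sideMap (P.sides f) 0 0) (sideMap (P.sides f) m 0) := by
    intro m
    induction m with
    | zero => simp [R.between_self]
    | succ m ih => rw [Finset.sum_range_succ, ih, R.between_add]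
  have h3 : sideMap (P.sides f) (P.sides f) 0 = sideMap (P.sides f) 0 0 :=
    Subtype.ext ((sidePoint_eq_iff (P.sides_pos f) _ _ _ _).2 ⟨1, by simp⟩)
  rw [h2, h3, R.between_self]

/-- A cocycle which is given by the differences of a function of the vertices on each arc vanishes
on closed paths. -/
theorem toFun_eq_zero_of_arcs [NeZero g] [T2Space S] [ChartedSpace (EuclideanSpace ℝ (Fin 2)) S]
    (P : CutPolygons a b)
    (hα : IsSimpleClosed α) (hβ : IsSimpleClosed β) (R : PathCocycle S) (h : S → ℝ)
    (hR : ∀ s, R.toFun (arcMap a b s) = h (dirArc a b s 1) - h (dirArc a b s 0))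
    (γ : C(I, S)) (hγ : γ 0 = γ 1) : R.toFun γ = 0 := by
  -- `val` is a primitive on each polygon, normalised to agree with `h` at the initial vertex of
  -- side 0; `w` is a primitive along each arc. The hypothesis on the arcs carries the agreement
  -- with `h` to every vertex, so the primitives of all polygons glue to a function on `S`.
  let val : (f : Fin P.num) → closedBall (0 : ℂ) 1 → ℝ := fun f z =>
    h (dirArc a b (P.label ⟨f, ⟨0, P.sides_pos f⟩⟩) 0) +
      R.between (P.disc f) (sideMap (P.sides f) 0 0) z
  let w : Symbol g → I → ℝ := fun s u => h (dirArc a b s 0) + R.between (arcMap a b s) 0 u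
  have hval_add : ∀ f z z', val f z' = val f z + R.between (P.disc f) z z' := by
    intro f z z'
    have := R.between_add (P.disc f) (sideMap (P.sides f) 0 0) z z'
    simp only [val]
    linarith
  have hside : ∀ f (k : Fin (P.sides f)) u, R.between (P.disc f) (sideMap (P.sides f) k 0)
      (sideMap (P.sides f) k u) = R.between (arcMap a b (P.label ⟨f, k⟩)) 0 u := by
    intro f k u
    rw [← P.disc_comp_sideMap, R.between_comp]
  have hw0 : ∀ s, w s 0 = h (dirArc a b s 0) := fun s => by simp [w, R.between_self]
  have hw1 : ∀ s, w s 1 = h (dirArc a b s 1) := fun s => by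
    simp only [w, ← R.toFun_eq_between, hR]; ring
  have hvertex : ∀ f (k : ℕ) (hk : k < P.sides f),
      val f (sideMap (P.sides f) k 0) = h (dirArc a b (P.label ⟨f, ⟨k, hk⟩⟩) 0) := by
    intro f k
    induction k with
    | zero =>
      intro hk
      simp [val, R.between_self]
    | succ k ih =>
      intro hk
      have hk' : k < P.sides f := by omega
      rw [← sideMap_one, hval_add f (sideMap (P.sides f) k 0), ih hk',
        hside f ⟨k, hk'⟩ 1, ← R.toFun_eq_between, hR, ← P.side_eq f ⟨k, hk'⟩ 1 (by simp),
        ← P.side_eq f ⟨k + 1, hk⟩ 0 (by simp), sidePoint_one]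
      ring
  have hval_side : ∀ f (k : Fin (P.sides f)) u,
      val f (sideMap (P.sides f) k u) = w (P.label ⟨f, k⟩) u := by
    intro f k u
    rw [hval_add f (sideMap (P.sides f) k 0), hvertex f k k.2, hside]
  have hw_inv : ∀ s u, w s.inv (unitInterval.symm u) = w s u := by
    intro s u
    have r1 := R.between_add (arcMap a b s) 0 1 u
    have r2 := hR s
    rw [R.toFun_eq_between] at r2
    simp only [w, arcMap_inv, R.between_comp, ContinuousMap.coe_mk, unitInterval.symm_zero,
      unitInterval.symm_symm, dirArc_inv, sub_zero]
    linarith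
  have hw_eq : ∀ s t (u v : I), dirArc a b s u = dirArc a b t v → w s u = w t v := by
    intro s t u v huv
    rcases dirArc_eq_dirArc a b hα hβ u.2 v.2 huv with ⟨rfl, h1⟩ | ⟨rfl, h1⟩ | ⟨h1, h2⟩
    · rw [Subtype.ext h1]
    · rw [← hw_inv s u, show unitInterval.symm u = v from Subtype.ext h1.symm]
    · have key : ∀ s (u : I), ((u : ℝ) = 0 ∨ (u : ℝ) = 1) → w s u = h (dirArc a b s u) := by
        intro s u hu
        rcases hu with hu | hu
        · rw [show u = 0 from Subtype.ext hu, hw0]; rfl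
        · rw [show u = 1 from Subtype.ext hu, hw1]; rfl
      rw [key s u h1, key t v h2, huv]
  have hval_eq : ∀ f f' z z', P.disc f z = P.disc f' z' → val f z = val f' z' := by
    intro f f' z z' hzz
    have hb : ∀ {z : closedBall (0 : ℂ) 1}, ‖(z : ℂ)‖ ≠ 1 → (z : ℂ) ∈ ball (0 : ℂ) 1 := by
      intro z hz
      have := z.2
      rw [mem_closedBall_zero_iff] at this
      rw [mem_ball_zero_iff]
      exact lt_of_le_of_ne this hz
    by_cases hz : ‖(z : ℂ)‖ = 1
    · by_cases hz' : ‖(z' : ℂ)‖ = 1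
      · obtain ⟨k, u, rfl⟩ := exists_sideMap_eq (P.sides_pos f) hz
        obtain ⟨k', u', rfl⟩ := exists_sideMap_eq (P.sides_pos f') hz'
        rw [hval_side, hval_side]
        apply hw_eq
        rw [← P.side_eq f k u u.2, ← P.side_eq f' k' u' u'.2]
        exact hzz
      · obtain ⟨rfl, h2⟩ := P.eq_of_toSurface_eq (hb hz') z.2 hzz
        rw [Subtype.ext h2]
    · obtain ⟨rfl, h2⟩ := P.eq_of_toSurface_eq (hb hz) z'.2 hzz.symm
      rw [Subtype.ext h2]
  have hsurj : ∀ x, ∃ p : Fin P.num × closedBall (0 : ℂ) 1, P.disc p.1 p.2 = x := by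
    intro x
    obtain ⟨f, z, hz, h⟩ := P.exists_toSurface_eq x
    exact ⟨(f, ⟨z, hz⟩), h⟩
  -- Any choice of preimages defines the glued function, since `hval_eq` makes its value independent
  -- of the choice.
  choose p hp using hsurj
  have hF : ∀ f z, val (p (P.disc f z)).1 (p (P.disc f z)).2 = val f z := fun f z =>
    hval_eq _ _ _ _ (hp _)
  rw [P.toFun_eq_sub_of_disc R (fun x => val (p x).1 (p x).2) ?_ γ, hγ, sub_self]
  intro f z z'
  rw [hF, hF, hval_add f z z']
  ring

end CutPolygons

/-! ### First homology and the Euler characteristic bound. -/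

/-- First homology classes of paths, after the choice of paths from a base point to all points. -/
theorem OrientableOfGenus.exists_class {g : ℕ} [PathConnectedSpace S] (hS : OrientableOfGenus S g) :
    ∃ κ : C(I, S) → Fin (2 * g) → ℤ,
      (∀ {x y z : S} (γ : Path x y) (δ : Path y z),
        κ (γ.trans δ).toContinuousMap = κ γ.toContinuousMap + κ δ.toContinuousMap) ∧
      (∀ {x y : S} {γ δ : Path x y}, γ.Homotopic δ →
        κ γ.toContinuousMap = κ δ.toContinuousMap) ∧
      ∀ v, ∃ γ : C(I, S), γ 0 = γ 1 ∧ κ γ = v := by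
  obtain ⟨x₀⟩ : Nonempty S := inferInstance
  obtain ⟨e⟩ := hS x₀
  let ρ : FundamentalGroup S x₀ →* Multiplicative (Fin (2 * g) → ℤ) :=
    e.toMonoidHom.comp Abelianization.of
  have hρ : Function.Surjective ρ := e.surjective.comp (QuotientGroup.mk_surjective)
  let q : ∀ x, Path.Homotopic.Quotient x₀ x := fun x => .mk (PathConnectedSpace.somePath x₀ x)
  let cl : ∀ {x y}, Path.Homotopic.Quotient x y → Fin (2 * g) → ℤ := fun {x y} γ =>
    (ρ (FundamentalGroup.fromPath (((q x).trans γ).trans (q y).symm))).toAdd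
  let κ : C(I, S) → Fin (2 * g) → ℤ := fun c =>
    cl (.mk (⟨c, rfl, rfl⟩ : Path (c 0) (c 1)))
  have hκ : ∀ {x y} (γ : Path x y), κ γ.toContinuousMap = cl (.mk γ) := by
    intro x y γ
    obtain ⟨c, rfl, rfl⟩ := γ
    rfl
  have hadd : ∀ {x y z} (γ : Path.Homotopic.Quotient x y) (δ : Path.Homotopic.Quotient y z),
      cl (γ.trans δ) = cl γ + cl δ := by
    intro x y z γ δ
    have h1 : ((q x).trans (γ.trans δ)).trans (q z).symm =
        (((q x).trans γ).trans (q y).symm).trans (((q y).trans δ).trans (q z).symm) := by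
      simp only [Path.Homotopic.Quotient.trans_assoc]
      rw [← Path.Homotopic.Quotient.trans_assoc (q y).symm, Path.Homotopic.Quotient.symm_trans,
        Path.Homotopic.Quotient.refl_trans]
    -- The product in the fundamental group is concatenation in the opposite order, which does not
    -- matter in an abelian target.
    have h2 := ρ.map_mul (FundamentalGroup.fromPath (((q y).trans δ).trans (q z).symm))
      (FundamentalGroup.fromPath (((q x).trans γ).trans (q y).symm))
    rw [FundamentalGroup.mul_def] at h2
    simp only [cl, h1]
    refine (congrArg Multiplicative.toAdd h2).trans ?_
    rw [toAdd_mul, add_comm]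
  refine ⟨κ, fun γ δ => ?_, fun h => ?_, fun v => ?_⟩
  · rw [hκ, hκ, hκ, Path.Homotopic.Quotient.mk_trans, hadd]
  · rw [hκ, hκ, Path.Homotopic.Quotient.eq.2 h]
  · obtain ⟨γ, hγ⟩ := hρ (Multiplicative.ofAdd v)
    obtain ⟨γ', rfl⟩ := Path.Homotopic.Quotient.mk_surjective (X := S) (x₀ := x₀) (x₁ := x₀) γ
    refine ⟨γ'.toContinuousMap, by simp, ?_⟩
    rw [hκ]
    -- The chosen path from the base point to itself need not be constant, but it only conjugates,
    -- and the target is abelian.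
    have h1 : ρ (FundamentalGroup.fromPath (((q x₀).trans (.mk γ')).trans (q x₀).symm)) =
        ρ (FundamentalGroup.fromPath (.mk γ')) := by
      have h2 : FundamentalGroup.fromPath (((q x₀).trans (.mk γ')).trans (q x₀).symm) =
          (FundamentalGroup.fromPath (q x₀))⁻¹ * (FundamentalGroup.fromPath (.mk γ') *
            FundamentalGroup.fromPath (q x₀)) := rfl
      rw [h2, map_mul, map_mul, map_inv, mul_comm (ρ _)⁻¹, mul_assoc, mul_inv_cancel, mul_one]
    simp only [cl]
    rw [h1]
    exact congrArg Multiplicative.toAdd hγ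

/-- The real combinations of the coordinates of the homology class. -/
def cocycleOfClass {n : ℕ} (κ : C(I, S) → Fin n → ℤ)
    (h₁ : ∀ {x y z : S} (γ : Path x y) (δ : Path y z),
      κ (γ.trans δ).toContinuousMap = κ γ.toContinuousMap + κ δ.toContinuousMap)
    (h₂ : ∀ {x y : S} {γ δ : Path x y}, γ.Homotopic δ →
      κ γ.toContinuousMap = κ δ.toContinuousMap) (c : Fin n → ℝ) : PathCocycle S where
  toFun γ := ∑ i, c i * κ γ i
  trans γ δ := by
    rw [h₁, ← Finset.sum_add_distrib]
    refine Finset.sum_congr rfl fun i _ => ?_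
    rw [Pi.add_apply]
    push_cast
    ring
  homotopic h := by rw [h₂ h]

theorem eq_of_finRotate_invariant {n : ℕ} {X : Type*} {φ : Fin n → X}
    (h : ∀ i, φ (finRotate n i) = φ i) (i j : Fin n) : φ i = φ j := by
  have h0 : 0 < n := i.pos
  have key : ∀ (k : ℕ) (hk : k < n), φ ⟨k, hk⟩ = φ ⟨0, h0⟩ := by
    intro k
    induction k with
    | zero => intro _; rfl
    | succ k ih =>
      intro hk
      rw [← ih (by omega), ← h ⟨k, by omega⟩]
      congr 1
      have := finRotate_val_emod (⟨k, by omega⟩ : Fin n)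
      simp only at this
      rw [Int.emod_eq_of_lt (by omega) (by omega)] at this
      exact Fin.ext (by simp only; omega)
  rw [key i i.2, key j j.2]

namespace Symbol

variable {g : ℕ}

/-- The symbols of the arcs in their own direction. -/
def pos : Fin (2 * g) ⊕ Fin (2 * g) → Symbol g := Sum.elim alpha beta

theorem eq_pos_or (s : Symbol g) : ∃ e, s = pos e ∨ s = (pos e).inv := by
  cases s with
  | alpha i => exact ⟨.inl i, Or.inl rfl⟩
  | beta i => exact ⟨.inr i, Or.inl rfl⟩
  | alphaInv i => exact ⟨.inl i, Or.inr rfl⟩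
  | betaInv i => exact ⟨.inr i, Or.inr rfl⟩

theorem pos_injective : Function.Injective (pos (g := g)) := by
  rintro (i | i) (j | j) h <;> simp_all [pos]

theorem pos_ne_inv_pos (e e' : Fin (2 * g) ⊕ Fin (2 * g)) : pos e ≠ (pos e').inv := by
  rcases e with i | i <;> rcases e' with j | j <;> simp [pos]

theorem sum_eq [Fintype (Symbol g)] (φ : Symbol g → ℝ) :
    ∑ s, φ s = ∑ e, (φ (pos e) + φ (pos e).inv) := by
  let E : (Fin (2 * g) ⊕ Fin (2 * g)) ⊕ (Fin (2 * g) ⊕ Fin (2 * g)) ≃ Symbol g :=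
    Equiv.ofBijective (Sum.elim pos fun e => (pos e).inv) (by
      constructor
      · rintro (e | e) (e' | e') h
        · rw [pos_injective h]
        · exact absurd h (pos_ne_inv_pos _ _)
        · exact absurd h.symm (pos_ne_inv_pos _ _)
        · rw [pos_injective (inv_injective h)]
      · intro s
        obtain ⟨e, rfl | rfl⟩ := eq_pos_or s
        · exact ⟨.inl e, rfl⟩
        · exact ⟨.inr e, rfl⟩)
  rw [← E.sum_comp, Fintype.sum_sum_type, Finset.sum_add_distrib]
  rfl

end Symbol

namespace CutPolygons

variable {α β : C(UnitAddCircle, S)} {g : ℕ} {a : Labelling α β (2 * g)} {b : Labelling β α (2 * g)}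
  (P : CutPolygons a b)

/-- Cellular cocycles are orthogonal to the boundaries of combinations of polygons. -/
theorem sum_mul_boundary_eq_zero {X : Symbol g → ℝ} (hinv : ∀ s, X s.inv = -X s)
    (hX : ∀ f, ∑ k, X (P.label ⟨f, k⟩) = 0) (w : Fin P.num → ℝ) :
    ∑ e, X (Symbol.pos e) * (w (P.face (Symbol.pos e)) - w (P.face (Symbol.pos e).inv)) = 0 := by
  have := Fintype.ofFinite (Symbol g)
  -- Summed polygon by polygon this vanishes. Summed arc by arc, pairing each symbol with its
  -- inverse, it is the desired expression.
  have h1 : ∑ s, X s * w (P.face s) = 0 := by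
    rw [← P.label.sum_comp, Fintype.sum_sigma]
    refine Finset.sum_eq_zero fun f _ => ?_
    simp only [face_label]
    rw [← Finset.sum_mul, hX, zero_mul]
  rw [Symbol.sum_eq] at h1
  rw [← h1]
  refine Finset.sum_congr rfl fun e _ => ?_
  rw [hinv]
  ring

/-- The Euler characteristic bounds the number of polygons. -/
theorem num_le_two [NeZero g] [T2Space S] [PathConnectedSpace S]
    [ChartedSpace (EuclideanSpace ℝ (Fin 2)) S] (hS : OrientableOfGenus S g)
    (hα : IsSimpleClosed α) (hβ : IsSimpleClosed β)
    (hnext : ∀ s, P.next (P.next s).inv = s.succ)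
    (halt : ∀ s, (P.next s).IsAlpha ↔ ¬ s.IsAlpha) : P.num ≤ 2 := by
  have hg := NeZero.pos g
  obtain ⟨κ, hκ₁, hκ₂, hκ₃⟩ := hS.exists_class
  let R : (Fin (2 * g) → ℝ) → PathCocycle S := cocycleOfClass κ hκ₁ hκ₂
  let i₀ : Fin (2 * g) := ⟨0, by omega⟩
  have : Nonempty (Fin (2 * g)) := ⟨i₀⟩
  -- Numbers the 2g vertices by the α-arcs starting there; its values at other points play no role.
  let vtx : S → Fin (2 * g) := Function.invFun fun i => dirArc a b (.alpha i) 0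
  have hvtx : ∀ i, vtx (dirArc a b (.alpha i) 0) = i := by
    refine Function.leftInverse_invFun fun i j hij => ?_
    simp only [dirArc_alpha_zero] at hij
    have h3 := a.apply_pt_eq hα hij
    rw [Int.emod_eq_of_lt (by omega) (by omega), Int.emod_eq_of_lt (by omega) (by omega)] at h3
    exact Fin.ext (by omega)
  have hvtx' : ∀ i, vtx (dirArc a b (.alpha i) 1) = finRotate _ i := by
    intro i
    rw [← dirArc_succ_zero]
    exact hvtx _
  -- A cellular cocycle: the homology coordinates combined with weights `c`, minus the coboundary of
  -- the vertex function `h`.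
  let X : (Fin (2 * g) → ℝ) → (Fin (2 * g) → ℝ) → Symbol g → ℝ := fun c h s =>
    (R c).toFun (arcMap a b s) - (h (vtx (dirArc a b s 1)) - h (vtx (dirArc a b s 0)))
  have hXinv : ∀ c h s, X c h s.inv = -X c h s := by
    intro c h s
    simp only [X, toFun_arcMap_inv, dirArc_inv, sub_self, sub_zero]
    ring
  have hXsum : ∀ c h f, ∑ k, X c h (P.label ⟨f, k⟩) = 0 := by
    intro c h f
    simp only [X, Finset.sum_sub_distrib, P.sum_toFun_side, zero_sub]
    have h1 : ∀ k, h (vtx (dirArc a b (P.label ⟨f, k⟩) 1)) =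
        h (vtx (dirArc a b (P.label ⟨f, finRotate _ k⟩) 0)) := by
      intro k
      rw [← P.dirArc_next_zero, P.next_label]
    simp only [h1]
    rw [Equiv.sum_comp (finRotate (P.sides f)) fun k => h (vtx (dirArc a b (P.label ⟨f, k⟩) 0))]
    simp
  let f₀ := P.face (.alpha i₀)
  -- Cocycle plus boundary of a combination of polygons, as a function on the edges. The last two
  -- entries remove the constants from `h` and `w`. Injectivity gives 2g + 2g + `num` ≤ 4g + 2.
  let Λ : ((Fin (2 * g) → ℝ) × (Fin (2 * g) → ℝ) × (Fin P.num → ℝ)) →ₗ[ℝ]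
      ((Fin (2 * g) ⊕ Fin (2 * g) → ℝ) × ℝ × ℝ) :=
    { toFun := fun p => (fun e => X p.1 p.2.1 (Symbol.pos e) +
        (p.2.2 (P.face (Symbol.pos e)) - p.2.2 (P.face (Symbol.pos e).inv)), p.2.1 i₀, p.2.2 f₀)
      map_add' := by
        intro p p'
        ext <;> simp [X, R, cocycleOfClass, add_mul, Finset.sum_add_distrib]; ring
      map_smul' := by
        intro r p
        ext <;> simp [X, R, cocycleOfClass, mul_assoc, ← Finset.mul_sum]; ring }
  have hΛ : Function.Injective Λ := by
    rw [← LinearMap.ker_eq_bot, LinearMap.ker_eq_bot']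
    rintro ⟨c, h, w⟩ hzero
    have h1 : ∀ e, X c h (Symbol.pos e) +
        (w (P.face (Symbol.pos e)) - w (P.face (Symbol.pos e).inv)) = 0 := fun e =>
      congrFun (congrArg Prod.fst hzero) e
    have h2 : h i₀ = 0 := congrArg (fun p => p.2.1) hzero
    have h3 : w f₀ = 0 := congrArg (fun p => p.2.2) hzero
    have horth := P.sum_mul_boundary_eq_zero (hXinv c h) (hXsum c h) w
    have hX0 : ∀ e, X c h (Symbol.pos e) = 0 := by
      -- On the kernel the boundary equals minus the cocycle, so orthogonality makes the cocycle
      -- orthogonal to itself.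
      have hs : ∑ e, X c h (Symbol.pos e) * X c h (Symbol.pos e) = 0 := by
        rw [← neg_eq_zero, ← Finset.sum_neg_distrib, ← horth]
        refine Finset.sum_congr rfl fun e _ => ?_
        have := h1 e
        rw [← mul_neg]
        congr 1
        linarith
      have h4 := (Finset.sum_eq_zero_iff_of_nonneg fun e _ => mul_self_nonneg _).1 hs
      exact fun e => mul_self_eq_zero.1 (h4 e (Finset.mem_univ e))
    have hX0' : ∀ s, X c h s = 0 := by
      intro s
      obtain ⟨e, rfl | rfl⟩ := s.eq_pos_or
      · exact hX0 e
      · rw [hXinv, hX0, neg_zero]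
    have hc : c = 0 := by
      ext j
      -- Evaluating on a closed path whose class is the j-th unit vector reads off `c j`, while a
      -- cocycle that is a coboundary on the arcs gives zero there.
      obtain ⟨γ, hγ, hγj⟩ := hκ₃ (Pi.single j 1)
      have h5 := toFun_eq_zero_of_arcs P hα hβ (R c) (h ∘ vtx)
        (fun s => sub_eq_zero.1 (hX0' s)) γ hγ
      simpa [R, cocycleOfClass, hγj, Pi.single_apply] using h5
    have hh : h = 0 := by
      have h5 : ∀ i, h (finRotate _ i) = h i := by
        intro i
        have := hX0' (.alpha i)
        simp only [X, hc, R, cocycleOfClass, Pi.zero_apply, zero_mul, Finset.sum_const_zero,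
          hvtx, hvtx'] at this
        linarith
      ext i
      rw [eq_of_finRotate_invariant h5 i i₀, h2]
      rfl
    have hw : w = 0 := by
      have h5 : ∀ s, w (P.face s.inv) = w (P.face s) := by
        intro s
        obtain ⟨e, rfl | rfl⟩ := s.eq_pos_or
        · have := h1 e
          rw [hX0] at this
          linarith
        · have := h1 e
          rw [hX0] at this
          rw [Symbol.inv_inv]
          linarith
      have h6 : ∀ i, w (P.face (.alpha i)) = 0 := by
        intro i
        -- Consecutive α-arcs are joined by `next`, reversal and `next`; `next` keeps the polygon
        -- and reversal keeps `w`.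
        have h7 : ∀ i, w (P.face (.alpha (finRotate _ i))) = w (P.face (.alpha i)) := by
          intro i
          have h8 := hnext (.alpha i)
          change _ = Symbol.alpha (finRotate _ i) at h8
          rw [← h8, P.face_next, h5, P.face_next]
        rw [eq_of_finRotate_invariant (φ := fun i => w (P.face (.alpha i))) h7 i i₀, h3]
      have h7 : ∀ s : Symbol g, s.IsAlpha → w (P.face s) = 0 := by
        intro s hs
        cases s with
        | alpha i => exact h6 i
        | alphaInv i => rw [← Symbol.inv_alpha, h5, h6]
        | beta i => exact hs.elim
        | betaInv i => exact hs.elim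
      ext f
      set s := P.label ⟨f, ⟨0, P.sides_pos f⟩⟩ with hs
      have hf : P.face s = f := P.face_label f _
      rw [← hf]
      by_cases hsα : s.IsAlpha
      · exact h7 s hsα
      · rw [← P.face_next s]
        exact h7 _ ((halt s).2 hsα)
    rw [hc, hh, hw]
    rfl
  have hdim := LinearMap.finrank_le_finrank_of_injective hΛ
  simp at hdim
  omega

end CutPolygons

/-! ### The permutations `Q` and `τ` in terms of symbols -/

theorem Symbol.index_bounds {g : ℕ} (s : Symbol g) : 1 ≤ s.index ∧ s.index ≤ 8 * g := by
  rcases s with i | i | i | i <;> have := i.2 <;> simp only [Symbol.index] <;> omega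

section Numbers

variable {g : ℕ} [NeZero g]

theorem natCast_inj_of_le {x y : ℕ} (hx : 1 ≤ x ∧ x ≤ 8 * g) (hy : 1 ≤ y ∧ y ≤ 8 * g)
    (h : (x : N g) = (y : N g)) : x = y := by
  obtain ⟨c, hc⟩ := (ZMod.intCast_eq_intCast_iff_dvd_sub (x : ℤ) y (8 * g)).1 (by exact_mod_cast h)
  have hg := NeZero.pos g
  push_cast at hc
  have h1 : c < 1 := by
    by_contra hcon
    nlinarith
  have h2 : -1 < c := by
    by_contra hcon
    nlinarith
  obtain rfl : c = 0 := by omega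
  omega

theorem cyc_apply {m : ℕ} {e : ℕ → ℕ} (he : ∀ i < m, 1 ≤ e i ∧ e i ≤ 8 * g)
    (hinj : ∀ i < m, ∀ j < m, e i = e j → i = j) {i : ℕ} (hi : i < m) :
    cyc g m e (e i : N g) = (e ((i + 1) % m) : N g) := by
  have hnodup : ((List.range m).map fun i => ((e i : ℕ) : N g)).Nodup := by
    refine List.Nodup.map_on (fun x hx y hy h => ?_) List.nodup_range
    rw [List.mem_range] at hx hy
    exact hinj x hx y hy (natCast_inj_of_le (he x hx) (he y hy) h)
  have := List.formPerm_apply_getElem _ hnodup i (by simpa using hi)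
  simpa [cyc] using this

theorem cyc_apply_of_ne {m : ℕ} {e : ℕ → ℕ} (he : ∀ i < m, 1 ≤ e i ∧ e i ≤ 8 * g) {x : ℕ}
    (hx : 1 ≤ x ∧ x ≤ 8 * g) (hne : ∀ i < m, e i ≠ x) : cyc g m e (x : N g) = x := by
  refine List.formPerm_apply_of_notMem fun h => ?_
  obtain ⟨i, hi, hix⟩ := List.mem_map.1 h
  rw [List.mem_range] at hi
  exact hne i hi (natCast_inj_of_le (he i hi) hx hix)

theorem Q_apply (x : N g) : Q g x = x + 1 := by
  have hg := NeZero.pos g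
  obtain ⟨s, rfl⟩ := (Symbol.equivN g).surjective x
  have hs := s.index_bounds
  have h := cyc_apply (g := g) (m := 8 * g) (e := fun i => i + 1) (fun i hi => by omega)
    (fun i _ j _ h => by omega) (i := s.index - 1) (by omega)
  simp only [Nat.sub_add_cancel hs.1] at h
  refine h.trans ?_
  push_cast
  rw [ZMod.natCast_mod]
  rfl

theorem Q_pow_apply (n : ℕ) (x : N g) : (Q g ^ n) x = x + (n : N g) := by
  induction n with
  | zero => simp
  | succ n ih =>
    rw [pow_succ', Equiv.Perm.mul_apply, ih, Q_apply]
    push_cast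
    ring

theorem Symbol.equivN_apply (s : Symbol g) : Symbol.equivN g s = (s.index : N g) := rfl

/-- This identifies reversal with `Q ^ (4 * g)`. For the inverse symbols the shift by 4g wraps
around modulo 8g. -/
theorem equivN_inv (s : Symbol g) :
    Symbol.equivN g s.inv = Symbol.equivN g s + ((4 * g : ℕ) : N g) := by
  have h8 : ((8 * g : ℕ) : N g) = 0 := ZMod.natCast_self _
  simp only [Symbol.equivN_apply]
  have key : ∀ x y : ℕ, x + 8 * g = y → (x : N g) = (y : N g) := by
    rintro x y rfl
    rw [Nat.cast_add, h8, add_zero]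
  rw [← Nat.cast_add]
  cases s with
  | alpha i => congr 1; simp only [Symbol.inv, Symbol.index]; omega
  | beta i => congr 1; simp only [Symbol.inv, Symbol.index]; omega
  | alphaInv i => apply key; simp only [Symbol.inv, Symbol.index]; omega
  | betaInv i => apply key; simp only [Symbol.inv, Symbol.index]; omega

theorem finRotate_val_mod {n : ℕ} (i : Fin n) : (finRotate n i : ℕ) = (i + 1) % n := by
  have := finRotate_val_emod i
  exact_mod_cast this

/-- The first two cycles of `tau` advance along α and β. The other two descend because inverse arcs
are met in the opposite order. -/
theorem tau_equivN (s : Symbol g) : tau g (Symbol.equivN g s) = Symbol.equivN g s.succ := by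
  have hg := NeZero.pos g
  have b1 : ∀ i < 2 * g, 1 ≤ 2 * i + 1 ∧ 2 * i + 1 ≤ 8 * g := fun i hi => by omega
  have b2 : ∀ i < 2 * g, 1 ≤ 2 * i + 2 ∧ 2 * i + 2 ≤ 8 * g := fun i hi => by omega
  have b3 : ∀ i < 2 * g, 1 ≤ 8 * g - 1 - 2 * i ∧ 8 * g - 1 - 2 * i ≤ 8 * g := fun i hi => by omega
  have b4 : ∀ i < 2 * g, 1 ≤ 8 * g - 2 * i ∧ 8 * g - 2 * i ≤ 8 * g := fun i hi => by omega
  have hrot := fun i : Fin (2 * g) => finRotate_val_mod i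
  have hs := s.index_bounds
  have ht := s.succ.index_bounds
  have hlt : ∀ i : Fin (2 * g), (i : ℕ) < 2 * g := fun i => i.2
  simp only [tau, Equiv.Perm.mul_apply, Symbol.equivN_apply]
  cases s with
  | alpha i =>
    have := hlt i
    rw [cyc_apply_of_ne b4 hs (fun j hj => by simp only [Symbol.index]; omega),
      cyc_apply_of_ne b3 hs (fun j hj => by simp only [Symbol.index]; omega),
      cyc_apply_of_ne b2 hs (fun j hj => by simp only [Symbol.index]; omega)]
    have h := cyc_apply b1 (fun i _ j _ h => by omega) this
    rw [show (Symbol.alpha i).index = 2 * (i : ℕ) + 1 by simp only [Symbol.index]; omega, h]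
    congr 1
    simp only [Symbol.succ, Symbol.index, hrot]
    omega
  | beta i =>
    have := hlt i
    rw [cyc_apply_of_ne b4 hs (fun j hj => by simp only [Symbol.index]; omega),
      cyc_apply_of_ne b3 hs (fun j hj => by simp only [Symbol.index]; omega)]
    have h := cyc_apply b2 (fun i _ j _ h => by omega) this
    rw [show (Symbol.beta i).index = 2 * (i : ℕ) + 2 by simp only [Symbol.index]; omega, h]
    have hm := Nat.mod_lt ((i : ℕ) + 1) (show 0 < 2 * g by omega)
    rw [cyc_apply_of_ne b1 (b2 _ hm) (fun j hj => by omega)]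
    congr 1
    simp only [Symbol.succ, Symbol.index, hrot]
    omega
  | alphaInv k =>
    -- Writing the index as a rotated one makes the inverse rotation in `succ` cancel. The
    -- descending cycle counts positions from the top, and wrap-around is a separate case.
    obtain ⟨i, rfl⟩ := (finRotate (2 * g)).surjective k
    have hi := hlt i
    have hm := hlt (finRotate _ i)
    rw [cyc_apply_of_ne b4 hs (fun j hj => by simp only [Symbol.index]; omega)]
    have h := cyc_apply b3 (fun i _ j _ h => by omega)
      (show 2 * g - 1 - (finRotate _ i : Fin (2 * g)) < 2 * g by omega)
    rw [show (Symbol.alphaInv (finRotate _ i)).index =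
      8 * g - 1 - 2 * (2 * g - 1 - ((finRotate _ i : Fin (2 * g)) : ℕ)) by
        simp only [Symbol.index]; omega, h]
    have hval : 8 * g - 1 - 2 * ((2 * g - 1 - ((finRotate _ i : Fin (2 * g)) : ℕ) + 1) % (2 * g)) =
        (Symbol.alphaInv (finRotate _ i)).succ.index := by
      simp only [Symbol.succ, Symbol.index, Equiv.symm_apply_apply, hrot]
      rcases Nat.lt_or_ge ((i : ℕ) + 1) (2 * g) with h1 | h1
      · rw [Nat.mod_eq_of_lt h1, Nat.mod_eq_of_lt (by omega)]
        omega
      · obtain h1 : (i : ℕ) + 1 = 2 * g := by omega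
        rw [h1, Nat.mod_self, Nat.sub_zero, Nat.sub_add_cancel (by omega), Nat.mod_self]
        omega
    rw [hval]
    rw [cyc_apply_of_ne b2 ht (fun j hj => by
        simp only [Symbol.succ, Symbol.index]; omega),
      cyc_apply_of_ne b1 ht (fun j hj => by
        simp only [Symbol.succ, Symbol.index]; omega)]
  | betaInv k =>
    obtain ⟨i, rfl⟩ := (finRotate (2 * g)).surjective k
    have hi := hlt i
    have hm := hlt (finRotate _ i)
    have h := cyc_apply b4 (fun i _ j _ h => by omega)
      (show 2 * g - 1 - (finRotate _ i : Fin (2 * g)) < 2 * g by omega)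
    rw [show (Symbol.betaInv (finRotate _ i)).index =
      8 * g - 2 * (2 * g - 1 - ((finRotate _ i : Fin (2 * g)) : ℕ)) by
        simp only [Symbol.index]; omega, h]
    have hval : 8 * g - 2 * ((2 * g - 1 - ((finRotate _ i : Fin (2 * g)) : ℕ) + 1) % (2 * g)) =
        (Symbol.betaInv (finRotate _ i)).succ.index := by
      simp only [Symbol.succ, Symbol.index, Equiv.symm_apply_apply, hrot]
      rcases Nat.lt_or_ge ((i : ℕ) + 1) (2 * g) with h1 | h1
      · rw [Nat.mod_eq_of_lt h1, Nat.mod_eq_of_lt (by omega)]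
        omega
      · obtain h1 : (i : ℕ) + 1 = 2 * g := by omega
        rw [h1, Nat.mod_self, Nat.sub_zero, Nat.sub_add_cancel (by omega), Nat.mod_self]
        omega
    rw [hval]
    rw [cyc_apply_of_ne b3 ht (fun j hj => by
        simp only [Symbol.succ, Symbol.index]; omega),
      cyc_apply_of_ne b2 ht (fun j hj => by
        simp only [Symbol.succ, Symbol.index]; omega),
      cyc_apply_of_ne b1 ht (fun j hj => by
        simp only [Symbol.succ, Symbol.index]; omega)]

/-- Since 4 divides 8g, replacing 8g by the residue 0 leaves remainders modulo 4 unchanged. -/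
theorem val_equivN_mod_four (s : Symbol g) : (Symbol.equivN g s).val % 4 = s.index % 4 := by
  rw [Symbol.equivN_apply, ZMod.val_natCast]
  exact Nat.mod_mod_of_dvd _ (by omega)

theorem even_val_equivN_iff (s : Symbol g) : Even (Symbol.equivN g s).val ↔ ¬ s.IsAlpha := by
  have h := val_equivN_mod_four s
  rw [Nat.even_iff]
  have h2 : (Symbol.equivN g s).val % 2 = s.index % 2 := by omega
  rw [h2]
  cases s <;> simp only [Symbol.index, Symbol.isAlpha_alpha, Symbol.isAlpha_alphaInv,
    Symbol.not_isAlpha_beta, Symbol.not_isAlpha_betaInv, not_true, not_false_iff, iff_true,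
    iff_false] <;> omega

end Numbers

/-! ### The cycles -/

namespace CutPolygons

variable {α β : C(UnitAddCircle, S)} {g : ℕ} {a : Labelling α β (2 * g)} {b : Labelling β α (2 * g)}
  (P : CutPolygons a b)

theorem perm_equivN [NeZero g] (s : Symbol g) :
    P.perm (Symbol.equivN g s) = Symbol.equivN g (P.next s) := by
  simp [perm, next]

/-- The cycles of φ are the polygons: rotating the sides preserves the polygon and is transitive on
its sides. -/
theorem sameCycle_iff [NeZero g] (s t : Symbol g) :
    P.perm.SameCycle (Symbol.equivN g s) (Symbol.equivN g t) ↔ P.face s = P.face t := by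
  constructor
  · rintro ⟨n, hn⟩
    let F : N g → Fin P.num := fun x => P.face ((Symbol.equivN g).symm x)
    have h1 : ∀ x, F (P.perm x) = F x := by
      intro x
      obtain ⟨s, rfl⟩ := (Symbol.equivN g).surjective x
      simp only [F, perm_equivN, Equiv.symm_apply_apply, face_next]
    have h2 : ∀ (n : ℤ) x, F ((P.perm ^ n) x) = F x := by
      intro n
      induction n using Int.induction_on with
      | zero => intro x; rfl
      | succ k ih => intro x; rw [zpow_add_one, Equiv.Perm.mul_apply, ih, h1]
      | pred k ih =>
        intro x
        rw [zpow_sub_one, Equiv.Perm.mul_apply, ih, ← h1, show P.perm ((P.perm)⁻¹ x) = x from P.perm.apply_symm_apply x]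
    have h3 := h2 n (Symbol.equivN g s)
    rw [hn] at h3
    simpa [F] using h3.symm
  · intro h
    have key : ∀ f (k : ℕ) (hk : k < P.sides f), P.perm.SameCycle
        (Symbol.equivN g (P.label ⟨f, ⟨0, P.sides_pos f⟩⟩))
        (Symbol.equivN g (P.label ⟨f, ⟨k, hk⟩⟩)) := by
      intro f k
      induction k with
      | zero => intro hk; exact Equiv.Perm.SameCycle.refl _ _
      | succ k ih =>
        intro hk
        have h1 := ih (by omega)
        rw [← Equiv.Perm.sameCycle_apply_right, perm_equivN, next_label] at h1
        have h2 : finRotate _ (⟨k, by omega⟩ : Fin (P.sides f)) = ⟨k + 1, hk⟩ := by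
          apply Fin.ext
          rw [finRotate_val_mod, Nat.mod_eq_of_lt hk]
        rwa [h2] at h1
    obtain ⟨f, k, rfl⟩ := P.exists_label_eq s
    obtain ⟨f', k', rfl⟩ := P.exists_label_eq t
    rw [face_label, face_label] at h
    subst h
    exact (key f k k.2).symm.trans (key f k' k'.2)

/-- If the curves cross at all their points of intersection, there are two polygons, and no arc of
the second curve borders both, then the polygons are the two sides of the first curve. -/
theorem face_structure [NeZero g] (hnext : ∀ s, P.next (P.next s).inv = s.succ)
    (halt : ∀ s, (P.next s).IsAlpha ↔ ¬ s.IsAlpha) (hnum : P.num = 2)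
    (hface : ∀ s : Symbol g, ¬ s.IsAlpha → P.face s.inv = P.face s) :
    (∀ i j, P.face (.alpha i) = P.face (.alpha j)) ∧
      (∀ i j, P.face (.alphaInv i) = P.face (.alphaInv j)) ∧
      (∀ i, P.face (.alpha i) ≠ P.face (.alphaInv i)) ∧
      ∀ i j, P.face (.beta i) = P.face (.beta j) → (i : ℕ) % 2 = j % 2 := by
  have hg := NeZero.pos g
  let i₀ : Fin (2 * g) := ⟨0, by omega⟩
  have hsucc : ∀ s : Symbol g, s.IsAlpha → P.face s.succ = P.face s := by
    intro s hs
    have h1 : ¬ (P.next s).IsAlpha := fun h => (halt s).1 h hs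
    -- Between two consecutive α-arcs one crosses a β-arc, which has the same polygon on both sides.
    rw [← hnext, P.face_next, hface _ h1, P.face_next]
  have h1 : ∀ i j, P.face (.alpha i) = P.face (.alpha j) :=
    eq_of_finRotate_invariant fun i => hsucc (.alpha i) trivial
  have h2 : ∀ i j, P.face (.alphaInv i) = P.face (.alphaInv j) := by
    refine eq_of_finRotate_invariant fun i => ?_
    have := hsucc (.alphaInv (finRotate _ i)) trivial
    simpa only [Symbol.succ, Equiv.symm_apply_apply] using this.symm
  have h3 : ∀ i, P.face (.alpha i) ≠ P.face (.alphaInv i) := by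
    intro i hi
    have h4 : ∀ s : Symbol g, s.IsAlpha → P.face s = P.face (.alpha i) := by
      intro s hs
      cases s with
      | alpha j => exact h1 j i
      | alphaInv j => rw [h2 j i, hi]
      | beta j => exact hs.elim
      | betaInv j => exact hs.elim
    have h5 : ∀ f, f = P.face (.alpha i) := by
      intro f
      rw [← P.face_label f ⟨0, P.sides_pos f⟩]
      set s := P.label ⟨f, ⟨0, P.sides_pos f⟩⟩
      by_cases hs : s.IsAlpha
      · exact h4 s hs
      · rw [← P.face_next s]
        exact h4 _ ((halt s).2 hs)
    -- Every polygon has an α-side by alternation, so if all α-sides lay on one polygon there could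
    -- not be two.
    have h6 := (h5 ⟨0, by omega⟩).trans (h5 ⟨1, by omega⟩).symm
    simp [Fin.ext_iff] at h6
  refine ⟨h1, h2, h3, ?_⟩
  have h4 : ∀ s : Symbol g, s.IsAlpha → P.face s.inv ≠ P.face s := by
    intro s hs
    cases s with
    | alpha i => exact (h3 i).symm
    | alphaInv i => exact h3 i
    | beta i => exact hs.elim
    | betaInv i => exact hs.elim
  have h5 : ∀ i, P.face (.beta (finRotate _ i)) ≠ P.face (.beta i) := by
    intro i
    -- Between two consecutive β-arcs one crosses α, which changes the polygon. With two polygons in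
    -- all, they alternate along β.
    have h6 := h4 (P.next (.beta i)) ((halt _).2 id)
    rw [← P.face_next, hnext, P.face_next] at h6
    exact h6
  have h6 : ∀ (k : ℕ) (hk : k < 2 * g), P.face (.beta ⟨k, hk⟩) = P.face (.beta i₀) ↔ k % 2 = 0 := by
    intro k
    induction k with
    | zero => intro hk; exact ⟨fun _ => rfl, fun _ => rfl⟩
    | succ k ih =>
      intro hk
      have h7 := ih (by omega)
      have h8 := h5 ⟨k, by omega⟩
      have h9 : finRotate (2 * g) ⟨k, by omega⟩ = ⟨k + 1, hk⟩ := by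
        apply Fin.ext
        rw [finRotate_val_mod, Nat.mod_eq_of_lt hk]
      rw [h9] at h8
      have f1 := (P.face (.beta ⟨k, by omega⟩)).2
      have f2 := (P.face (.beta ⟨k + 1, hk⟩)).2
      have f3 := (P.face (.beta i₀)).2
      simp only [Fin.ext_iff, ne_eq] at h7 h8 ⊢
      omega
  intro i j hij
  have h7 := h6 i i.2
  have h8 := h6 j j.2
  rw [Fin.eta] at h7 h8
  rw [hij, h8] at h7
  omega

/-- The two cycles are those through α_1 and its inverse. Their supports are the label sets of the
two polygons, so every claim reduces to which polygon a symbol borders. -/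
theorem perm_structure [NeZero g] (hnext : ∀ s, P.next (P.next s).inv = s.succ)
    (halt : ∀ s, (P.next s).IsAlpha ↔ ¬ s.IsAlpha) (hnum : P.num = 2)
    (hface : ∀ s : Symbol g, ¬ s.IsAlpha → P.face s.inv = P.face s) :
    ∃ c₁ c₂ : Equiv.Perm (N g),
      c₁.IsCycle ∧ c₂.IsCycle ∧ c₁.support.card = 4 * g ∧ c₂.support.card = 4 * g ∧
      c₁.Disjoint c₂ ∧ P.perm = c₁ * c₂ ∧
      (∀ i < 2 * g, ((2 * i + 1 : ℕ) : N g) ∈ c₁.support) ∧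
      (∀ i < 2 * g, ((4 * g + 2 * i + 1 : ℕ) : N g) ∈ c₂.support) ∧
      ∀ c ∈ ({c₁, c₂} : Set (Equiv.Perm (N g))),
        (∀ i : ℕ, ((2 * i : ℕ) : N g) ∈ c.support → ((2 * i + 4 * g : ℕ) : N g) ∈ c.support) ∧
        ((∃ k : ℕ, ((4 * k + 2 : ℕ) : N g) ∈ c.support) →
          ∀ x ∈ c.support, Even x.val → ∃ k : ℕ, x.val = 4 * k + 2) ∧
        ((∃ k : ℕ, ((4 * k : ℕ) : N g) ∈ c.support) →
          ∀ x ∈ c.support, Even x.val → ∃ k : ℕ, x.val = 4 * k) := by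
  classical
  have hg := NeZero.pos g
  obtain ⟨h1, h2, h3, h4⟩ := P.face_structure hnext halt hnum hface
  let i₀ : Fin (2 * g) := ⟨0, by omega⟩
  let E := Symbol.equivN g
  let c : Symbol g → Equiv.Perm (N g) := fun s => P.perm.cycleOf (E s)
  have hne : ∀ s, P.perm (E s) ≠ E s := by
    intro s h
    rw [P.perm_equivN] at h
    have := halt s
    rw [E.injective h] at this
    tauto
  have hsupp : ∀ s t, E t ∈ (c s).support ↔ P.face s = P.face t := fun s t => by
    rw [Equiv.Perm.mem_support_cycleOf_iff' (hne s), P.sameCycle_iff]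
  have happ : ∀ s t, c s (E t) = if P.face s = P.face t then E (P.next t) else E t := by
    intro s t
    simp only [c, Equiv.Perm.cycleOf_apply, E, P.sameCycle_iff, P.perm_equivN]
  have hcard : ∀ e : Fin (2 * g) → Symbol g, Function.Injective e → (∀ i, (e i).IsAlpha) →
      (∀ s : Symbol g, s.IsAlpha → P.face (e i₀) = P.face s → ∃ i, e i = s) →
      (∀ i, P.face (e i₀) = P.face (e i)) → (c (e i₀)).support.card = 4 * g := by
    intro e he heα hsurj hef
    -- The sides of the polygon are its 2g sides on α and their successors, which by alternation are
    -- its sides on β.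
    let ψ : Fin (2 * g) ⊕ Fin (2 * g) → N g := Sum.elim (fun i => E (e i)) fun i => E (P.next (e i))
    have hψ : Function.Injective ψ := by
      have hno : ∀ i j, E (e i) ≠ E (P.next (e j)) := by
        intro i j h
        have h5 := heα i
        rw [E.injective h, halt] at h5
        exact h5 (heα j)
      rintro (i | i) (j | j) h
      · rw [he (E.injective h)]
      · exact absurd h (hno i j)
      · exact absurd h.symm (hno j i)
      · rw [he (P.next.injective (E.injective h))]
    have himg : (c (e i₀)).support = Finset.univ.image ψ := by
      ext x
      obtain ⟨t, rfl⟩ := E.surjective x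
      rw [hsupp, Finset.mem_image]
      constructor
      · intro ht
        by_cases htα : t.IsAlpha
        · obtain ⟨i, rfl⟩ := hsurj t htα ht
          exact ⟨.inl i, Finset.mem_univ _, rfl⟩
        · obtain ⟨r, rfl⟩ := P.next.surjective t
          have hr : r.IsAlpha := by
            by_contra hr
            exact htα ((halt r).2 hr)
          rw [P.face_next] at ht
          obtain ⟨i, rfl⟩ := hsurj r hr ht
          exact ⟨.inr i, Finset.mem_univ _, rfl⟩
      · rintro ⟨i | i, -, hi⟩
        · rw [← E.injective hi]
          exact hef i
        · rw [← E.injective hi, P.face_next]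
          exact hef i
    rw [himg, Finset.card_image_of_injective _ hψ, Finset.card_univ, Fintype.card_sum,
      Fintype.card_fin]
    omega
  have hcov : ∀ t, P.face (.alpha i₀) = P.face t ↔ P.face (.alphaInv i₀) ≠ P.face t := by
    intro t
    have f1 := (P.face (.alpha i₀)).2
    have f2 := (P.face (.alphaInv i₀)).2
    have f3 := (P.face t).2
    have f4 := h3 i₀
    simp only [ne_eq, Fin.ext_iff] at f4 ⊢
    omega
  -- Since `i` counts from zero, β_{i+1} and its inverse have index 2(i + 1) modulo 4, so the
  -- remainder 2 or 0 records the parity of `i`, which determines the polygon.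
  have hβ : ∀ s : Symbol g, ¬ s.IsAlpha → ∃ i : Fin (2 * g), P.face s = P.face (.beta i) ∧
      (s.index % 4 = 2 ↔ (i : ℕ) % 2 = 0) ∧ (s.index % 4 = 0 ↔ (i : ℕ) % 2 = 1) := by
    intro s hs
    cases s with
    | alpha i => exact absurd trivial hs
    | alphaInv i => exact absurd trivial hs
    | beta i => exact ⟨i, rfl, by simp only [Symbol.index]; omega, by simp only [Symbol.index]; omega⟩
    | betaInv i =>
      refine ⟨i, hface (.beta i) id, ?_, ?_⟩ <;> simp only [Symbol.index] <;> omega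
  have hmod : ∀ (m : ℕ) (s : Symbol g), E s = (m : N g) → s.index % 4 = m % 4 := by
    intro m s h
    rw [← val_equivN_mod_four]
    change (E s).val % 4 = _
    rw [h, ZMod.val_natCast]
    exact Nat.mod_mod_of_dvd _ (by omega)
  have heven : ∀ s : Symbol g, s.index % 4 = 0 ∨ s.index % 4 = 2 → ¬ s.IsAlpha := by
    intro s hs
    rw [← even_val_equivN_iff, Nat.even_iff]
    have := val_equivN_mod_four s
    omega
  refine ⟨c (.alpha i₀), c (.alphaInv i₀), Equiv.Perm.isCycle_cycleOf _ (hne _),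
    Equiv.Perm.isCycle_cycleOf _ (hne _), ?_, ?_, ?_, ?_, ?_, ?_, ?_⟩
  · refine hcard Symbol.alpha (fun i j h => by simpa using h) (fun _ => trivial) ?_ (h1 i₀)
    intro s hs hf
    cases s with
    | alpha i => exact ⟨i, rfl⟩
    | alphaInv i => exact absurd (hf.trans (h2 i i₀)) (h3 i₀)
    | beta i => exact hs.elim
    | betaInv i => exact hs.elim
  · refine hcard Symbol.alphaInv (fun i j h => by simpa using h) (fun _ => trivial) ?_ (h2 i₀)
    intro s hs hf
    cases s with
    | alphaInv i => exact ⟨i, rfl⟩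
    | alpha i => exact absurd ((h1 i₀ i).trans hf.symm) (h3 i₀)
    | beta i => exact hs.elim
    | betaInv i => exact hs.elim
  · intro x
    obtain ⟨t, rfl⟩ := E.surjective x
    have := hcov t
    rw [happ, happ]
    by_cases h : P.face (.alpha i₀) = P.face t
    · right
      rw [if_neg (this.1 h)]
    · left
      rw [if_neg h]
  · ext1 x
    obtain ⟨t, rfl⟩ := E.surjective x
    have := hcov t
    rw [Equiv.Perm.mul_apply, happ (.alphaInv i₀)]
    by_cases h : P.face (.alpha i₀) = P.face t
    · rw [if_neg (this.1 h), happ, if_pos h]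
      exact P.perm_equivN t
    · have h' : P.face (.alphaInv i₀) = P.face t := by tauto
      rw [if_pos h', happ, P.face_next, if_neg h]
      exact P.perm_equivN t
  · intro i hi
    have h5 := (hsupp (.alpha i₀) (.alpha ⟨i, hi⟩)).2 (h1 _ _)
    rwa [show E (.alpha ⟨i, hi⟩) = ((2 * i + 1 : ℕ) : N g) from
      congrArg Nat.cast (by simp only [Symbol.index]; omega)] at h5
  · intro i hi
    have h5 := (hsupp (.alphaInv i₀) (.alphaInv ⟨i, hi⟩)).2 (h2 _ _)
    rwa [show E (.alphaInv ⟨i, hi⟩) = ((4 * g + 2 * i + 1 : ℕ) : N g) from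
      congrArg Nat.cast (by simp only [Symbol.index]; omega)] at h5
  · have key : ∀ s₀, (∀ i : ℕ, ((2 * i : ℕ) : N g) ∈ (c s₀).support →
          ((2 * i + 4 * g : ℕ) : N g) ∈ (c s₀).support) ∧
        ((∃ k : ℕ, ((4 * k + 2 : ℕ) : N g) ∈ (c s₀).support) →
          ∀ x ∈ (c s₀).support, Even x.val → ∃ k : ℕ, x.val = 4 * k + 2) ∧
        ((∃ k : ℕ, ((4 * k : ℕ) : N g) ∈ (c s₀).support) →
          ∀ x ∈ (c s₀).support, Even x.val → ∃ k : ℕ, x.val = 4 * k) := by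
      intro s₀
      have hpar : ∀ (m : ℕ), m % 2 = 0 → (m : N g) ∈ (c s₀).support → ∀ x ∈ (c s₀).support,
          Even x.val → x.val % 4 = m % 4 := by
        intro m hm hmem x hx hxe
        obtain ⟨s, hs⟩ := E.surjective (m : N g)
        obtain ⟨t, rfl⟩ := E.surjective x
        rw [← hs, hsupp] at hmem
        rw [hsupp] at hx
        have hsm := hmod m s hs
        have htm : (E t).val % 4 = t.index % 4 := val_equivN_mod_four t
        obtain ⟨i, hi, hi1, hi2⟩ := hβ s (heven s (by omega))
        obtain ⟨j, hj, hj1, hj2⟩ := hβ t ((even_val_equivN_iff t).1 hxe)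
        have hij := h4 i j (by rw [← hi, ← hj, ← hmem, hx])
        omega
      refine ⟨fun i hi => ?_, ?_, ?_⟩
      · obtain ⟨s, hs⟩ := E.surjective ((2 * i : ℕ) : N g)
        have hsm := hmod _ s hs
        rw [← hs, hsupp] at hi
        have h5 := (hsupp s₀ s.inv).2 (by rw [hi, hface s (heven s (by omega))])
        rwa [show E s.inv = ((2 * i + 4 * g : ℕ) : N g) by
          rw [Nat.cast_add, ← hs]; exact equivN_inv s] at h5
      · rintro ⟨k, hk⟩ x hx hxe
        have := hpar _ (by omega) hk x hx hxe
        exact ⟨x.val / 4, by omega⟩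
      · rintro ⟨k, hk⟩ x hx hxe
        have := hpar _ (by omega) hk x hx hxe
        exact ⟨x.val / 4, by omega⟩
    rintro _ (rfl | rfl)
    · exact key _
    · exact key _

end CutPolygons

end FillingPair

end

open FillingPair in
theorem mainTheorem6 {S : Type*} [TopologicalSpace S] [T2Space S] [CompactSpace S]
    [ConnectedSpace S] [ChartedSpace (EuclideanSpace ℝ (Fin 2)) S]
    (g : ℕ) [NeZero g] (hS : OrientableOfGenus S g)
    (α β : C(UnitAddCircle, S)) (h : IsMinimalSeparatingFillingPair g α β)
    (a : Labelling α β (2 * g)) (b : Labelling β α (2 * g)) (P : CutPolygons a b) :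
    (∀ k : N g, (Even k.val → Odd (P.perm k).val) ∧ (Odd k.val → Even (P.perm k).val)) ∧
    (∃ c₁ c₂ : Equiv.Perm (N g),
      c₁.IsCycle ∧ c₂.IsCycle ∧ c₁.support.card = 4 * g ∧ c₂.support.card = 4 * g ∧
      c₁.Disjoint c₂ ∧ P.perm = c₁ * c₂ ∧
      (∀ i < 2 * g, ((2 * i + 1 : ℕ) : N g) ∈ c₁.support) ∧
      (∀ i < 2 * g, ((4 * g + 2 * i + 1 : ℕ) : N g) ∈ c₂.support) ∧
      ∀ c ∈ ({c₁, c₂} : Set (Equiv.Perm (N g))),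
        (∀ i : ℕ, ((2 * i : ℕ) : N g) ∈ c.support → ((2 * i + 4 * g : ℕ) : N g) ∈ c.support) ∧
        ((∃ k : ℕ, ((4 * k + 2 : ℕ) : N g) ∈ c.support) →
          ∀ x ∈ c.support, Even x.val → ∃ k : ℕ, x.val = 4 * k + 2) ∧
        ((∃ k : ℕ, ((4 * k : ℕ) : N g) ∈ c.support) →
          ∀ x ∈ c.support, Even x.val → ∃ k : ℕ, x.val = 4 * k)) ∧
    P.perm * Q g ^ (4 * g) * P.perm = tau g := by
  have : LocallyPathConnectedSpace S :=
    ChartedSpace.locallyPathConnectedSpace (EuclideanSpace ℝ (Fin 2)) S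
  have : PathConnectedSpace S := pathConnectedSpace_iff_connectedSpace.2 inferInstance
  have hα := h.filling.simple_left
  have hβ := h.filling.simple_right
  have hmin := h.filling.minimal_position
  have hfin : (Set.range α ∩ Set.range β).Finite :=
    Set.finite_of_encard_eq_coe (hmin.trans h.inter)
  have hcross := P.next_inv_next_and_isAlpha_next hα hβ hmin hfin
  have hnext := fun s => (hcross s).1
  have halt := fun s => (hcross s).2
  obtain ⟨hnum, hface⟩ := P.num_eq_two_and_face_inv_eq
    (P.num_le_two hS hα hβ hnext halt) h.separating
  refine ⟨fun k => ?_, P.perm_structure hnext halt hnum hface, ?_⟩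
  · obtain ⟨s, rfl⟩ := (Symbol.equivN g).surjective k
    rw [P.perm_equivN, ← Nat.not_even_iff_odd, ← Nat.not_even_iff_odd, even_val_equivN_iff,
      even_val_equivN_iff, halt]
    tauto
  -- With `Q ^ (4 * g)` as reversal and `tau` as successor, this is the crossing relation `hnext`.
  · ext1 k
    obtain ⟨s, rfl⟩ := (Symbol.equivN g).surjective k
    rw [Equiv.Perm.mul_apply, Equiv.Perm.mul_apply, P.perm_equivN, Q_pow_apply, ← equivN_inv,
      P.perm_equivN, hnext, tau_equivN]
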